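/- Fix an integer $k\ge 2$. For real $d>1$ (large enough for the following to make sense) put $$\alpha(d)=\left(\frac{(k-1)d}{\log d-5(k-1)\log\log d}\right)^{1/(k-1)},\qquad \beta(d)=3(\log d)^{3k}.$$ Let $H_{n,m;k}$ be the random $k$-uniform hypergraph on vertex set $[n]$ whose edge set is a uniformly random set of $m$ distinct $k$-subsets of $[n]$. For a hypergraph $H$ let $\Gamma_q(H)$ be the graph whose vertices are the proper $q$-colorings of $H$ (maps $\sigma:V(H)\to[q]$ under which no edge is monochromatic), two colorings being adjacent when they differ at exactly one vertex. Then there is $d_0=d_0(k)$ such that the following holds for every $D\ge d_0$, every sequence $d=d(n)\in[d_0,D]$, $m=\lfloor dn/k\rfloor$, and every sequence of positive integers $q=q(n)$. (i) If $q\ge \alpha(d)+\beta(d)+1$ for all $n$, then $\Pr[\Gamma_q(H_{n,m;k})\text{ is connected}]\to 1$ as $n\to\infty$. (ii) There is a constant $C=C(k,D)$, not depending on the sequences $d$ and $q$, such that if $q\ge \alpha(d)+2\beta(d)+1$ for all $n$, then $\Pr[\Gamma_q(H_{n,m;k})\text{ is connected and has diameter at most }Cn]\to 1$ as $n\to\infty$.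 -/

import Mathlib

open Filter Topology

noncomputable section

/-- A map `σ : V → C` is a proper coloring of the hypergraph with edge set `E` if no edge is
monochromatic, i.e. every edge receives at least two colors. -/
def IsProperColoring {V C : Type*} [DecidableEq C] (E : Finset (Finset V)) (σ : V → C) : Prop :=
  ∀ e ∈ E, 2 ≤ (e.image σ).card

/-- The recoloring graph: its vertices are the proper `q`-colorings of the hypergraph on
`Fin n` with edge set `E`; two of them are adjacent when they differ at exactly one vertex. -/
def recoloringGraph {n : ℕ} (E : Finset (Finset (Fin n))) (q : ℕ) :
    SimpleGraph {σ : Fin n → Fin q // IsProperColoring E σ} where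
  Adj σ τ := hammingDist σ.1 τ.1 = 1
  symm := ⟨fun σ τ h => (hammingDist_comm τ.1 σ.1).trans h⟩
  loopless := ⟨fun σ h => by simp at h⟩

/-- The possible edge sets of a `k`-uniform hypergraph on `Fin n` with exactly `m` edges. -/
def uniformHypergraphs (n m k : ℕ) : Finset (Finset (Finset (Fin n))) :=
  Finset.powersetCard m (Finset.powersetCard k Finset.univ)

open Classical in
/-- The probability that the random `k`-uniform hypergraph on `Fin n`, whose edge set is a
uniformly random set of `m` distinct `k`-subsets of `Fin n`, has the property `P`. -/
def randomHypergraphProb (n m k : ℕ) (P : Finset (Finset (Fin n)) → Prop) : ℝ :=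
  ((uniformHypergraphs n m k).filter P).card / (uniformHypergraphs n m k).card

/-- `α = ((k-1) d / (log d - 5 (k-1) log log d))^(1/(k-1))`. -/
def alphaParam (k : ℕ) (d : ℝ) : ℝ :=
  (((k : ℝ) - 1) * d / (Real.log d - 5 * ((k : ℝ) - 1) * Real.log (Real.log d))) ^
    (1 / ((k : ℝ) - 1))

/-- `β = 3 (log d)^(3k)`. -/
def betaParam (k : ℕ) (d : ℝ) : ℝ :=
  3 * Real.log d ^ (3 * k)

end

/-! The proof separates a deterministic property of the hypergraph, `GreedyDegenerate E r κ`, from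
the estimate that it holds with high probability.

Deterministic half. On a `κ`-degenerate vertex set with a palette of at least `3κ + 2` colors of its
own, any two proper colorings are joined by recoloring each vertex at most three times
(`IsDegenerate.exists_moves`): vertices are added in degeneracy order, and a new vertex avoids the
next `2κ + 1` colors to appear on its at most `κ` constraining neighbors. Edges leaving the set are
harmless, because colors outside the palette appear there. If the vertices left by `r` greedy
classes always span a degenerate hypergraph and `q ≥ r + 3κ + 2`, any coloring can be made greedy
and then freed of the last color. That free color is a buffer through which the classes of a greedy
target are installed one at a time; afterwards only the degenerate remainder differs
(`exists_fix_class`, `exists_common`). The total cost is `O(r² n)`, and `r ≤ D`.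

Probabilistic half. A vertex outside the first `r` greedy classes is blocked by an edge into each of
them. For fixed classes these events use disjoint sets of potential edges, hence are independent in
the binomial model, which dominates the uniform one up to a polynomial factor. A union bound over
labelled vertex sets (`randomHypergraphProb_hasSaturated_le`) shows that a window of greedy classes
must shrink the uncolored set. Three windows, the first with nearly all of the `α` colors and the
others much shorter, bring the remainder to about `n d^(-1/(k-1))` vertices up to powers of `log d`.
No set that small is dense, so the remainder is degenerate with polylogarithmic constant, and its
palette fits into `β`. -/

set_option linter.unusedSectionVars false

/-! ### Recoloring a degenerate hypergraph -/

section Recoloring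

variable {V C : Type*} [DecidableEq V] [DecidableEq C]

theorem isProperColoring_iff {E : Finset (Finset V)} {σ : V → C} :
    IsProperColoring E σ ↔ ∀ e ∈ E, ∃ x ∈ e, ∃ y ∈ e, σ x ≠ σ y := by
  unfold IsProperColoring
  refine forall₂_congr fun e _ => ?_
  have : 2 ≤ (e.image σ).card ↔ 1 < (e.image σ).card := Iff.rfl
  rw [this, Finset.one_lt_card]
  simp

theorem IsProperColoring.congr {E : Finset (Finset V)} {W : Finset V} (hE : ∀ e ∈ E, e ⊆ W)
    {σ τ : V → C} (h : ∀ x ∈ W, σ x = τ x) (hσ : IsProperColoring E σ) :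
    IsProperColoring E τ := by
  rw [isProperColoring_iff] at hσ ⊢
  intro e he
  obtain ⟨x, hx, y, hy, hxy⟩ := hσ e he
  exact ⟨x, hx, y, hy, by rwa [← h x (hE e he hx), ← h y (hE e he hy)]⟩

theorem IsProperColoring.mono {E F : Finset (Finset V)} (h : E ⊆ F) {σ : V → C}
    (hσ : IsProperColoring F σ) : IsProperColoring E σ :=
  fun e he => hσ e (h he)

theorem IsProperColoring.perm_comp {E : Finset (Finset V)} {σ : V → C}
    (hσ : IsProperColoring E σ) (π : Equiv.Perm C) : IsProperColoring E (π ∘ σ) := by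
  rw [isProperColoring_iff] at hσ ⊢
  intro e he
  obtain ⟨x, hx, y, hy, hxy⟩ := hσ e he
  exact ⟨x, hx, y, hy, by simpa using hxy⟩

/-- The edges contained in a vertex set. -/
def edgesWithin (E : Finset (Finset V)) (W : Finset V) : Finset (Finset V) :=
  E.filter (· ⊆ W)

theorem edgesWithin_subset {E : Finset (Finset V)} {W : Finset V} :
    ∀ e ∈ edgesWithin E W, e ⊆ W := fun _ he => (Finset.mem_filter.1 he).2

/-- Every nonempty subset of `U` spans a hypergraph with a vertex of degree at most `κ`. -/
def IsDegenerate (E : Finset (Finset V)) (κ : ℕ) (U : Finset V) : Prop :=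
  ∀ W ⊆ U, W.Nonempty → ∃ v ∈ W, (E.filter (fun e => v ∈ e ∧ e ⊆ W)).card ≤ κ

/-- One vertex other than `v` is chosen from each of the at most `κ` edges at `v` inside `W`. If the
color of `v` differs from those on `N`, all these edges are safe, so adding `v` behaves as in a
`κ`-degenerate graph. -/
theorem IsDegenerate.exists_representatives {E : Finset (Finset V)} {κ : ℕ} {U W : Finset V}
    (h : IsDegenerate E κ U) (hE : ∀ e ∈ E, 2 ≤ e.card) (hW : W ⊆ U) (hne : W.Nonempty) :
    ∃ v ∈ W, ∃ N ⊆ W.erase v, N.card ≤ κ ∧ ∀ e ∈ E, v ∈ e → e ⊆ W → ∃ x ∈ e, x ∈ N := by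
  obtain ⟨v, hv, hcard⟩ := h W hW hne
  have hrep : ∀ e : Finset V, ∃ x, e ∈ E → x ∈ e ∧ x ≠ v := by
    intro e
    by_cases he : e ∈ E
    · obtain ⟨x, hx, hxv⟩ := Finset.exists_mem_ne (hE e he) v
      exact ⟨x, fun _ => ⟨hx, hxv⟩⟩
    · exact ⟨v, fun h => absurd h he⟩
  choose rep hrep using hrep
  refine ⟨v, hv, (E.filter (fun e => v ∈ e ∧ e ⊆ W)).image rep, ?_,
    Finset.card_image_le.trans hcard, ?_⟩
  · intro x hx
    obtain ⟨e, he, rfl⟩ := Finset.mem_image.1 hx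
    obtain ⟨heE, -, heW⟩ := Finset.mem_filter.1 he
    exact Finset.mem_erase.2 ⟨(hrep e heE).2, heW (hrep e heE).1⟩
  · intro e he hve heW
    exact ⟨rep e, (hrep e he).1, Finset.mem_image.2
      ⟨e, Finset.mem_filter.2 ⟨he, hve, heW⟩, rfl⟩⟩

theorem isProperColoring_edgesWithin_of_erase {E : Finset (Finset V)} {W N : Finset V} {v : V}
    (hN : ∀ e ∈ E, v ∈ e → e ⊆ W → ∃ x ∈ e, x ∈ N) {f : V → C}
    (hf : IsProperColoring (edgesWithin E (W.erase v)) f) (hv : ∀ x ∈ N, f x ≠ f v) :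
    IsProperColoring (edgesWithin E W) f := by
  rw [isProperColoring_iff] at hf ⊢
  intro e he
  obtain ⟨heE, heW⟩ := Finset.mem_filter.1 he
  by_cases hve : v ∈ e
  · obtain ⟨x, hx, hxN⟩ := hN e heE hve heW
    exact ⟨x, hx, v, hve, hv x hxN⟩
  · refine hf e (Finset.mem_filter.2 ⟨heE, fun x hx => Finset.mem_erase.2 ⟨?_, heW hx⟩⟩)
    rintro rfl
    exact hve hx

/-- Greedy coloring in degeneracy order: the vertex added last has at most `κ` forbidden colors. -/
theorem IsDegenerate.exists_coloring {E : Finset (Finset V)} {κ : ℕ} {U : Finset V}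
    (h : IsDegenerate E κ U) (hE : ∀ e ∈ E, 2 ≤ e.card) (P : Finset C) (hP : κ < P.card)
    (σ : V → C) :
    ∃ τ : V → C, (∀ x, x ∉ U → τ x = σ x) ∧ (∀ x ∈ U, τ x ∈ P) ∧
      IsProperColoring (edgesWithin E U) τ := by
  suffices H : ∀ s, ∀ W ⊆ U, W.card = s → ∃ τ : V → C, (∀ x, x ∉ W → τ x = σ x) ∧
      (∀ x ∈ W, τ x ∈ P) ∧ IsProperColoring (edgesWithin E W) τ from H _ U subset_rfl rfl
  intro s
  induction s with
  | zero =>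
    intro W _ hc
    obtain rfl := Finset.card_eq_zero.1 hc
    refine ⟨σ, fun _ _ => rfl, by simp, ?_⟩
    intro e he
    obtain ⟨heE, he0⟩ := Finset.mem_filter.1 he
    have := hE e heE
    rw [Finset.subset_empty.1 he0] at this
    simp at this
  | succ s ih =>
    intro W hW hc
    obtain ⟨v, hv, N, hNW, hNc, hN⟩ :=
      h.exists_representatives hE hW (Finset.card_pos.1 (by omega))
    obtain ⟨τ, h1, h2, h3⟩ := ih (W.erase v) ((Finset.erase_subset _ _).trans hW)
      (by rw [Finset.card_erase_of_mem hv]; omega)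
    obtain ⟨c, hcP, hcN⟩ : ∃ c ∈ P, c ∉ N.image τ :=
      Finset.exists_mem_notMem_of_card_lt_card
        (Finset.card_image_le.trans hNc |>.trans_lt hP)
    have hvN : ∀ x ∈ N, x ≠ v := fun x hx => (Finset.mem_erase.1 (hNW hx)).1
    refine ⟨Function.update τ v c, ?_, ?_, ?_⟩
    · intro x hx
      have hxv : x ≠ v := by rintro rfl; exact hx hv
      rw [Function.update_of_ne hxv]
      exact h1 x fun hx' => hx (Finset.mem_of_mem_erase hx')
    · intro x hx
      by_cases hxv : x = v
      · subst hxv; simpa using hcP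
      · rw [Function.update_of_ne hxv]; exact h2 x (Finset.mem_erase.2 ⟨hxv, hx⟩)
    · refine isProperColoring_edgesWithin_of_erase hN
        (h3.congr edgesWithin_subset fun x hx => ?_) ?_
      · rw [Function.update_of_ne (Finset.mem_erase.1 hx).1]
      · intro x hx
        rw [Function.update_of_ne (hvN x hx), Function.update_self]
        rintro rfl
        exact hcN (Finset.mem_image_of_mem _ hx)

/-- The coloring obtained by performing a list of single-vertex recolorings. -/
def runMoves (σ : V → C) : List (V × C) → V → C
  | [] => σ
  | m :: L => runMoves (Function.update σ m.1 m.2) L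

/-- Every coloring produced along a list of single-vertex recolorings is proper. -/
def ValidMoves (E : Finset (Finset V)) (σ : V → C) : List (V × C) → Prop
  | [] => True
  | m :: L => IsProperColoring E (Function.update σ m.1 m.2) ∧
      ValidMoves E (Function.update σ m.1 m.2) L

theorem ValidMoves.congr {E : Finset (Finset V)} {W : Finset V} (hE : ∀ e ∈ E, e ⊆ W)
    {L : List (V × C)} {σ τ : V → C} (h : ∀ x ∈ W, σ x = τ x) (hσ : ValidMoves E σ L) :
    ValidMoves E τ L := by
  induction L generalizing σ τ with
  | nil => trivial
  | cons m L ih =>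
    have h' : ∀ x ∈ W, Function.update σ m.1 m.2 x = Function.update τ m.1 m.2 x := by
      intro x hx
      by_cases hxm : x = m.1
      · subst hxm; simp
      · simp [Function.update_of_ne hxm, h x hx]
    exact ⟨hσ.1.congr hE h', ih h' hσ.2⟩

theorem runMoves_congr {W : Finset V} {L : List (V × C)} {σ τ : V → C}
    (h : ∀ x ∈ W, σ x = τ x) : ∀ x ∈ W, runMoves σ L x = runMoves τ L x := by
  induction L generalizing σ τ with
  | nil => exact h
  | cons m L ih =>
    refine ih fun x hx => ?_
    by_cases hxm : x = m.1
    · subst hxm; simp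
    · simp [Function.update_of_ne hxm, h x hx]

theorem runMoves_append (σ : V → C) (L L' : List (V × C)) :
    runMoves σ (L ++ L') = runMoves (runMoves σ L) L' := by
  induction L generalizing σ with
  | nil => rfl
  | cons m L ih => exact ih _

theorem validMoves_append {E : Finset (Finset V)} {σ : V → C} {L L' : List (V × C)} :
    ValidMoves E σ (L ++ L') ↔ ValidMoves E σ L ∧ ValidMoves E (runMoves σ L) L' := by
  induction L generalizing σ with
  | nil => simp [ValidMoves, runMoves]
  | cons m L ih => simp [ValidMoves, runMoves, ih, and_assoc]

/-- The colors used by the moves of a list that affect a vertex of `N`. -/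
def colorsOn (N : Finset V) (L : List (V × C)) : List C :=
  (L.filter (fun m => m.1 ∈ N)).map Prod.snd

theorem exists_fresh_color {P : Finset C} {N : Finset V} {κ J : ℕ} (hN : N.card ≤ κ)
    (hP : κ + J < P.card) (f : V → C) (l : List C) :
    ∃ c ∈ P, (∀ x ∈ N, f x ≠ c) ∧ c ∉ l.take J := by
  have h1 : (N.image f ∪ (l.take J).toFinset).card < P.card := by
    refine (Finset.card_union_le _ _).trans_lt (lt_of_le_of_lt (Nat.add_le_add
      (Finset.card_image_le.trans hN) ((List.toFinset_card_le _).trans ?_)) hP)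
    rw [List.length_take]; exact min_le_left _ _
  obtain ⟨c, hc, hc'⟩ := Finset.exists_mem_notMem_of_card_lt_card h1
  rw [Finset.mem_union, not_or, List.mem_toFinset] at hc'
  exact ⟨c, hc, fun x hx h => hc'.1 (Finset.mem_image.2 ⟨x, hx, h⟩), hc'.2⟩

/-- Lift a recoloring of `W \ {v}` to `W`, recoloring `v` only when the lookahead is exhausted. -/
theorem exists_lift_moves {E : Finset (Finset V)} {W N : Finset V} {v : V} {κ J : ℕ}
    {P : Finset C} (hv : v ∈ W) (hNW : N ⊆ W.erase v) (hNc : N.card ≤ κ)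
    (hN : ∀ e ∈ E, v ∈ e → e ⊆ W → ∃ x ∈ e, x ∈ N) (hP : κ + J < P.card) (hJ : 0 < J)
    (L : List (V × C)) (hL : ∀ m ∈ L, m.1 ∈ W.erase v ∧ m.2 ∈ P) (σ : V → C)
    (hval : ValidMoves (edgesWithin E (W.erase v)) σ L)
    (hσ : IsProperColoring (edgesWithin E (W.erase v)) σ)
    (hσv : ∀ x ∈ N, σ x ≠ σ v) (j : ℕ) (hj : j ≤ J) (hfree : σ v ∉ (colorsOn N L).take j) :
    ∃ L' : List (V × C), (∀ m ∈ L', m.1 ∈ W ∧ m.2 ∈ P) ∧ ValidMoves (edgesWithin E W) σ L' ∧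
      (∀ x ∈ W.erase v, runMoves σ L' x = runMoves σ L x) ∧
      (∀ x, x ≠ v → (L'.map Prod.fst).count x = (L.map Prod.fst).count x) ∧
      J * (L'.map Prod.fst).count v + j ≤ (colorsOn N L).length + J := by
  have hvN : ∀ x ∈ N, x ≠ v := fun x hx => (Finset.mem_erase.1 (hNW hx)).1
  -- Amortization: `j` is the number of coming moves on `N` whose colors the present color of `v` is
  -- known to avoid. A move on `N` lowers `j` by one, and `v` is recolored only at `j = 0`, which
  -- resets `j` to `J`. Hence each recoloring of `v` is paid for by `J` moves on `N`.
  induction L generalizing σ j with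
  | nil => exact ⟨[], by simp, trivial, fun _ _ => rfl, fun _ _ => rfl, by simpa using by omega⟩
  | cons m L ih =>
    have hm := hL m (by simp)
    have hmv : v ≠ m.1 := fun h => (Finset.mem_erase.1 hm.1).1 h.symm
    have hL' : ∀ m ∈ L, m.1 ∈ W.erase v ∧ m.2 ∈ P := fun m' h' => hL m' (by simp [h'])
    -- one step, keeping the color of `v`
    have key : ∀ (σ : V → C) (j : ℕ), j ≤ J →
        ValidMoves (edgesWithin E (W.erase v)) σ (m :: L) → (∀ x ∈ N, σ x ≠ σ v) →
        (m.1 ∈ N → m.2 ≠ σ v) → σ v ∉ (colorsOn N L).take j →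
        ∃ L' : List (V × C), (∀ m ∈ L', m.1 ∈ W ∧ m.2 ∈ P) ∧
          ValidMoves (edgesWithin E W) σ L' ∧
          (∀ x ∈ W.erase v, runMoves σ L' x = runMoves σ (m :: L) x) ∧
          (∀ x, x ≠ v → (L'.map Prod.fst).count x = ((m :: L).map Prod.fst).count x) ∧
          J * (L'.map Prod.fst).count v + j ≤ (colorsOn N L).length + J := by
      intro σ j hj hval hσv hm2 hfree
      have hu : Function.update σ m.1 m.2 v = σ v := Function.update_of_ne hmv _ _
      have hN' : ∀ x ∈ N, Function.update σ m.1 m.2 x ≠ Function.update σ m.1 m.2 v := by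
        intro x hx
        rw [hu]
        by_cases hxm : x = m.1
        · subst hxm; simpa using hm2 hx
        · rw [Function.update_of_ne hxm]; exact hσv x hx
      obtain ⟨L', h1, h2, h3, h4, h5⟩ := ih hL' (Function.update σ m.1 m.2) hval.2 hval.1 hN' j hj
        (by rwa [hu])
      refine ⟨m :: L', ?_, ⟨isProperColoring_edgesWithin_of_erase hN hval.1 hN', h2⟩, h3, ?_, ?_⟩
      · intro m' hm'
        rcases List.mem_cons.1 hm' with rfl | hm'
        · exact ⟨Finset.mem_of_mem_erase hm.1, hm.2⟩
        · exact h1 m' hm'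
      · intro x hx
        simp only [List.map_cons, List.count_cons, h4 x hx]
      · simpa only [List.map_cons, List.count_cons_of_ne hmv.symm] using h5
    by_cases hmN : m.1 ∈ N
    · have hcol : colorsOn N (m :: L) = m.2 :: colorsOn N L := by simp [colorsOn, hmN]
      rw [hcol] at hfree ⊢
      cases j with
      | succ j =>
        rw [List.take_succ_cons, List.mem_cons, not_or] at hfree
        obtain ⟨L', h1, h2, h3, h4, h5⟩ := key σ j (by omega) hval hσv
          (fun _ h => hfree.1 h.symm) hfree.2
        exact ⟨L', h1, h2, h3, h4, by simp only [List.length_cons]; omega⟩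
      | zero =>
        -- The next move may use the color of `v`, so `v` moves first, to a color avoiding that move
        -- and the `J - 1` after it.
        obtain ⟨c, hcP, hcN, hcl⟩ := exists_fresh_color hNc hP σ (m.2 :: colorsOn N L)
        obtain ⟨J, rfl⟩ : ∃ J', J = J' + 1 := ⟨J - 1, by omega⟩
        rw [List.take_succ_cons, List.mem_cons, not_or] at hcl
        have hagree : ∀ x ∈ W.erase v, σ x = Function.update σ v c x := fun x hx => by
          rw [Function.update_of_ne (Finset.mem_erase.1 hx).1]
        have hne : ∀ x ∈ N, Function.update σ v c x ≠ Function.update σ v c v := by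
          intro x hx
          rw [Function.update_of_ne (hvN x hx), Function.update_self]
          exact hcN x hx
        obtain ⟨L', h1, h2, h3, h4, h5⟩ := key (Function.update σ v c) J (by omega)
          (hval.congr edgesWithin_subset hagree) hne
          (fun _ h => hcl.1 (by simpa using h.symm)) (by simpa using hcl.2)
        refine ⟨(v, c) :: L', ?_, ⟨isProperColoring_edgesWithin_of_erase hN
          (hσ.congr edgesWithin_subset hagree) hne, h2⟩, ?_, ?_, ?_⟩
        · intro m' hm'
          rcases List.mem_cons.1 hm' with rfl | hm'
          · exact ⟨hv, hcP⟩
          · exact h1 m' hm'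
        · intro x hx
          exact (h3 x hx).trans (runMoves_congr (fun y hy => (hagree y hy).symm) x hx)
        · intro x hx
          rw [← h4 x hx]
          simp [hx.symm]
        · simp only [List.map_cons, List.count_cons_self, List.length_cons]
          nlinarith
    · have hcol : colorsOn N (m :: L) = colorsOn N L := by simp [colorsOn, hmN]
      rw [hcol] at hfree ⊢
      exact key σ j hj hval hσv (fun h => absurd h hmN) hfree

theorem length_colorsOn_le (N : Finset V) (L : List (V × C)) (M : ℕ)
    (h : ∀ x, (L.map Prod.fst).count x ≤ M) : (colorsOn N L).length ≤ M * N.card := by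
  have h1 : (colorsOn N L).length = ∑ x ∈ N, (L.map Prod.fst).count x := by
    induction L with
    | nil => simp [colorsOn]
    | cons m L ih =>
      have ih' := ih fun x => le_trans (by simp [List.count_cons]) (h x)
      by_cases hm : m.1 ∈ N
      · have : colorsOn N (m :: L) = m.2 :: colorsOn N L := by simp [colorsOn, hm]
        rw [this, List.length_cons, ih']
        simp [List.count_cons, Finset.sum_add_distrib, hm]
      · have : colorsOn N (m :: L) = colorsOn N L := by simp [colorsOn, hm]
        rw [this, ih']
        simp [List.count_cons, Finset.sum_add_distrib, hm]
  rw [h1]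
  calc _ ≤ ∑ x ∈ N, M := Finset.sum_le_sum fun x _ => h x
    _ = _ := by simp [mul_comm]

/-- Two proper colorings of a degenerate hypergraph from a palette with sufficiently many colors
can be joined by moves that recolor every vertex at most three times. -/
theorem IsDegenerate.exists_moves {E : Finset (Finset V)} {κ : ℕ} {U : Finset V}
    (h : IsDegenerate E κ U) (hE : ∀ e ∈ E, 2 ≤ e.card) (P : Finset C) (hP : 3 * κ + 1 < P.card)
    {σ τ : V → C} (hτP : ∀ x ∈ U, τ x ∈ P)
    (hσ : IsProperColoring (edgesWithin E U) σ) (hτ : IsProperColoring (edgesWithin E U) τ) :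
    ∃ L : List (V × C), (∀ m ∈ L, m.1 ∈ U ∧ m.2 ∈ P) ∧ ValidMoves (edgesWithin E U) σ L ∧
      (∀ x ∈ U, runMoves σ L x = τ x) ∧ ∀ x, (L.map Prod.fst).count x ≤ 3 := by
  suffices H : ∀ s, ∀ W ⊆ U, W.card = s →
      ∃ L : List (V × C), (∀ m ∈ L, m.1 ∈ W ∧ m.2 ∈ P) ∧ ValidMoves (edgesWithin E W) σ L ∧
      (∀ x ∈ W, runMoves σ L x = τ x) ∧ ∀ x, (L.map Prod.fst).count x ≤ 3 from
    H _ U subset_rfl rfl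
  intro s
  induction s with
  | zero =>
    intro W _ hc
    obtain rfl := Finset.card_eq_zero.1 hc
    exact ⟨[], by simp, trivial, by simp, by simp⟩
  | succ s ih =>
    intro W hW hc
    obtain ⟨v, hv, N, hNW, hNc, hN⟩ :=
      h.exists_representatives hE hW (Finset.card_pos.1 (by omega))
    obtain ⟨L, h1, h2, h3, h4⟩ := ih (W.erase v) ((Finset.erase_subset _ _).trans hW)
      (by rw [Finset.card_erase_of_mem hv]; omega)
    have hvN : ∀ x ∈ N, x ≠ v := fun x hx => (Finset.mem_erase.1 (hNW hx)).1
    have hsub : ∀ {X Y : Finset V}, X ⊆ Y → edgesWithin E X ⊆ edgesWithin E Y := fun hXY e he =>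
      Finset.mem_filter.2 ⟨(Finset.mem_filter.1 he).1, (Finset.mem_filter.1 he).2.trans hXY⟩
    -- At most `κ` colors on `N` and `2κ + 1` upcoming ones are excluded; this is what `3 * κ + 1 <
    -- P.card` pays for.
    obtain ⟨c, hcP, hcN, hcl⟩ := exists_fresh_color (J := 2 * κ + 1) (P := P) hNc (by omega) σ
      (colorsOn N L)
    have hagree : ∀ x ∈ W.erase v, σ x = Function.update σ v c x := fun x hx => by
      rw [Function.update_of_ne (Finset.mem_erase.1 hx).1]
    have hne : ∀ x ∈ N, Function.update σ v c x ≠ Function.update σ v c v := by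
      intro x hx
      rw [Function.update_of_ne (hvN x hx), Function.update_self]
      exact hcN x hx
    have hσ' : IsProperColoring (edgesWithin E (W.erase v)) (Function.update σ v c) :=
      (hσ.mono (hsub ((Finset.erase_subset _ _).trans hW))).congr edgesWithin_subset hagree
    obtain ⟨L', g1, g2, g3, g4, g5⟩ := exists_lift_moves (J := 2 * κ + 1) (P := P) hv hNW hNc hN
      (by omega) (by omega) L h1 (Function.update σ v c) (h2.congr edgesWithin_subset hagree) hσ'
      hne (2 * κ + 1) le_rfl (by simpa using hcl)
    -- `L` makes at most `3κ` moves on `N`, fewer than `2 (2κ + 1)`, so `v` is recolored at most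
    -- once along the lift. With the initial move to `c` and the final one to `τ v` this makes
    -- three.
    have hcount : (L'.map Prod.fst).count v ≤ 1 := by
      have := length_colorsOn_le N L 3 h4
      by_contra! hlt
      have h2 : 2 ≤ (L'.map Prod.fst).count v := hlt
      nlinarith
    have hend : ∀ x ∈ W, Function.update (runMoves (Function.update σ v c) L') v (τ v) x = τ x := by
      intro x hx
      by_cases hxv : x = v
      · subst hxv; simp
      · rw [Function.update_of_ne hxv]
        have hx' : x ∈ W.erase v := Finset.mem_erase.2 ⟨hxv, hx⟩
        rw [g3 x hx', ← h3 x hx']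
        exact runMoves_congr (fun y hy => (hagree y hy).symm) x hx'
    refine ⟨(v, c) :: (L' ++ [(v, τ v)]), ?_, ⟨isProperColoring_edgesWithin_of_erase hN hσ' hne,
      validMoves_append.2 ⟨g2, ?_, trivial⟩⟩, ?_, ?_⟩
    · intro m hm
      simp only [List.mem_cons, List.mem_append, List.not_mem_nil, or_false] at hm
      rcases hm with rfl | hm | rfl
      · exact ⟨hv, hcP⟩
      · exact g1 m hm
      · exact ⟨hv, hτP v (hW hv)⟩
    · exact (hτ.mono (hsub hW)).congr edgesWithin_subset fun x hx => (hend x hx).symm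
    · intro x hx
      simpa [runMoves, runMoves_append] using hend x hx
    · intro x
      by_cases hxv : x = v
      · subst hxv
        simp only [List.map_cons, List.map_append, List.map_nil, List.count_cons_self,
          List.count_append, List.count_nil]
        omega
      · have := h4 x
        have := g4 x hxv
        simp only [List.map_cons, List.map_append, List.map_nil, List.count_append,
          List.count_cons_of_ne (Ne.symm hxv), List.count_nil]
        omega

end Recoloring

/-! ### Paths of single-vertex recolorings -/

section RecolorPath

variable {V C : Type*} [DecidableEq V] [DecidableEq C]

/-- `RecolorPath E N σ τ`: the coloring `τ` arises from `σ` by at most `N` recolorings of single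
vertices such that all colorings after the first one are proper. -/
inductive RecolorPath (E : Finset (Finset V)) : ℕ → (V → C) → (V → C) → Prop
  | refl (N : ℕ) (σ : V → C) : RecolorPath E N σ σ
  | step {N : ℕ} {σ τ : V → C} (v : V) (c : C) : RecolorPath E N σ τ →
      IsProperColoring E (Function.update τ v c) →
      RecolorPath E (N + 1) σ (Function.update τ v c)

theorem RecolorPath.mono {E : Finset (Finset V)} {N : ℕ} {σ τ : V → C}
    (h : RecolorPath E N σ τ) : ∀ {M : ℕ}, N ≤ M → RecolorPath E M σ τ := by
  induction h with
  | refl N σ => exact fun _ => .refl _ _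
  | step v c _ hp ih =>
    intro M hM
    obtain ⟨M, rfl⟩ : ∃ M', M = M' + 1 := ⟨M - 1, by omega⟩
    exact .step v c (ih (by omega)) hp

theorem RecolorPath.trans {E : Finset (Finset V)} {N M : ℕ} {ρ σ τ : V → C}
    (h : RecolorPath E N ρ σ) (h' : RecolorPath E M σ τ) : RecolorPath E (N + M) ρ τ := by
  induction h' with
  | refl M σ => exact h.mono (by omega)
  | step v c _ hp ih => exact .step v c (ih h) hp

theorem RecolorPath.perm_comp {E : Finset (Finset V)} {N : ℕ} {σ τ : V → C}
    (h : RecolorPath E N σ τ) (π : Equiv.Perm C) : RecolorPath E N (π ∘ σ) (π ∘ τ) := by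
  induction h with
  | refl N σ => exact .refl _ _
  | step v c _ hp ih =>
    have hp' := hp.perm_comp π
    rw [Function.comp_update] at hp' ⊢
    exact .step v _ ih hp'

theorem RecolorPath.isProperColoring {E : Finset (Finset V)} {N : ℕ} {σ τ : V → C}
    (h : RecolorPath E N σ τ) (hσ : IsProperColoring E σ) : IsProperColoring E τ := by
  cases h with
  | refl => exact hσ
  | step v c _ hp => exact hp

theorem ValidMoves.recolorPath {E : Finset (Finset V)} {σ : V → C} {L : List (V × C)}
    (h : ValidMoves E σ L) : RecolorPath E L.length σ (runMoves σ L) := by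
  induction L generalizing σ with
  | nil => exact .refl _ _
  | cons m L ih =>
    have h1 : RecolorPath E 1 σ (Function.update σ m.1 m.2) := .step _ _ (.refl 0 σ) h.1
    exact (h1.trans (ih h.2)).mono (by simp [add_comm])

/-- Since `c` was unused, an edge that becomes monochromatic would have to lie wholly in the
recolored set. -/
theorem recolorPath_piecewise {E : Finset (Finset V)} {σ : V → C} (hσ : IsProperColoring E σ)
    {c : C} (hc : ∀ v, σ v ≠ c) (S : Finset V) (hS : ∀ e ∈ E, ∃ x ∈ e, x ∉ S) :
    RecolorPath E S.card σ (S.piecewise (fun _ => c) σ) := by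
  induction S using Finset.induction_on with
  | empty => simpa using RecolorPath.refl 0 σ
  | insert v S hv ih =>
    have ih' := ih fun e he => by
      obtain ⟨x, hx, hxS⟩ := hS e he
      exact ⟨x, hx, fun h => hxS (Finset.mem_insert_of_mem h)⟩
    have hp : IsProperColoring E ((insert v S).piecewise (fun _ => c) σ) := by
      rw [isProperColoring_iff] at hσ ⊢
      intro e he
      obtain ⟨x, hx, hxS⟩ := hS e he
      by_cases hy : ∃ y ∈ e, y ∈ insert v S
      · obtain ⟨y, hye, hy⟩ := hy
        refine ⟨x, hx, y, hye, ?_⟩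
        rw [Finset.piecewise_eq_of_notMem _ _ _ hxS, Finset.piecewise_eq_of_mem _ _ _ hy]
        exact hc x
      · push Not at hy
        obtain ⟨a, ha, b, hb, hab⟩ := hσ e he
        refine ⟨a, ha, b, hb, ?_⟩
        rwa [Finset.piecewise_eq_of_notMem _ _ _ (hy a ha),
          Finset.piecewise_eq_of_notMem _ _ _ (hy b hb)]
    rw [Finset.piecewise_insert] at hp ⊢
    rw [Finset.card_insert_of_notMem hv]
    exact .step v c ih' hp

/-- Moves inside `U` with colors from `P` stay proper for the whole hypergraph if `P` is used
exactly on `U`. -/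
theorem ValidMoves.of_edgesWithin {E : Finset (Finset V)} {U : Finset V} {P : Finset C}
    {L : List (V × C)} (hL : ∀ m ∈ L, m.1 ∈ U ∧ m.2 ∈ P) {σ : V → C}
    (h : ValidMoves (edgesWithin E U) σ L) (hσ : IsProperColoring E σ)
    (hU : ∀ x, x ∈ U ↔ σ x ∈ P) :
    ValidMoves E σ L ∧ ∀ x, x ∉ U → runMoves σ L x = σ x := by
  induction L generalizing σ with
  | nil => exact ⟨trivial, fun _ _ => rfl⟩
  | cons m L ih =>
    have hm := hL m (by simp)
    have hoff : ∀ x, x ∉ U → Function.update σ m.1 m.2 x = σ x := fun x hx =>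
      Function.update_of_ne (by rintro rfl; exact hx hm.1) _ _
    have hU' : ∀ x, x ∈ U ↔ Function.update σ m.1 m.2 x ∈ P := by
      intro x
      by_cases hx : x = m.1
      · subst hx; simp [hm.1, hm.2]
      · rw [Function.update_of_ne hx]; exact hU x
    have hp : IsProperColoring E (Function.update σ m.1 m.2) := by
      rw [isProperColoring_iff] at hσ ⊢
      intro e he
      by_cases heU : e ⊆ U
      · exact isProperColoring_iff.1 h.1 e (Finset.mem_filter.2 ⟨he, heU⟩)
      · obtain ⟨w, hwe, hwU⟩ := Finset.not_subset.1 heU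
        by_cases hy : ∃ y ∈ e, y ∈ U
        · obtain ⟨y, hye, hyU⟩ := hy
          refine ⟨y, hye, w, hwe, fun h => hwU ?_⟩
          rw [hU' w, ← h]
          exact (hU' y).1 hyU
        · push Not at hy
          obtain ⟨a, ha, b, hb, hab⟩ := hσ e he
          exact ⟨a, ha, b, hb, by rwa [hoff a (hy a ha), hoff b (hy b hb)]⟩
    obtain ⟨h1, h2⟩ := ih (fun m' h' => hL m' (by simp [h'])) h.2 hp hU'
    exact ⟨⟨hp, h1⟩, fun x hx => (h2 x hx).trans (hoff x hx)⟩

theorem IsDegenerate.exists_recolorPath [Fintype V] {E : Finset (Finset V)} {κ : ℕ} {U : Finset V}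
    (h : IsDegenerate E κ U) (hE : ∀ e ∈ E, 2 ≤ e.card) (P : Finset C) (hP : 3 * κ + 1 < P.card)
    {σ τ : V → C} (hσ : IsProperColoring E σ) (hU : ∀ x, x ∈ U ↔ σ x ∈ P)
    (hτP : ∀ x ∈ U, τ x ∈ P) (hτσ : ∀ x, x ∉ U → τ x = σ x)
    (hτ : IsProperColoring (edgesWithin E U) τ) :
    RecolorPath E (3 * Fintype.card V) σ τ := by
  obtain ⟨L, h1, h2, h3, h4⟩ := h.exists_moves hE P hP hτP
    (hσ.mono (Finset.filter_subset _ _)) hτ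
  obtain ⟨h5, h6⟩ := h2.of_edgesWithin h1 hσ hU
  have hrun : runMoves σ L = τ := by
    funext x
    by_cases hx : x ∈ U
    · exact h3 x hx
    · rw [h6 x hx, hτσ x hx]
  have hlen : L.length ≤ 3 * Fintype.card V := by
    have := length_colorsOn_le Finset.univ L 3 h4
    simpa [colorsOn] using this
  exact hrun ▸ h5.recolorPath.mono hlen

end RecolorPath

/-! ### Greedy color classes and the deterministic connectivity argument -/

section Greedy

variable {V : Type*} [DecidableEq V]

/-- For `i < r`, no vertex with a color larger than `i` can be recolored to `i`. -/
def GreedyUpTo (E : Finset (Finset V)) (f : V → ℕ) (r : ℕ) : Prop :=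
  ∀ i < r, ∀ v, i < f v → ∃ e ∈ E, v ∈ e ∧ ∀ u ∈ e, u ≠ v → f u = i

theorem GreedyUpTo.mono {E : Finset (Finset V)} {f : V → ℕ} {r s : ℕ} (h : GreedyUpTo E f r)
    (hs : s ≤ r) : GreedyUpTo E f s := fun i hi => h i (hi.trans_le hs)

theorem GreedyUpTo.congr {E : Finset (Finset V)} {f g : V → ℕ} {r : ℕ} (h : GreedyUpTo E f r)
    (hfg : ∀ v, ∀ i < r, (f v = i ↔ g v = i)) : GreedyUpTo E g r := by
  intro i hi v hv
  obtain ⟨e, he, hve, hu⟩ := h i hi v (by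
    by_contra! hle
    have := (hfg v (f v) (by omega)).1 rfl
    omega)
  exact ⟨e, he, hve, fun u hue huv => (hfg u i hi).1 (hu u hue huv)⟩

theorem le_iff_of_agree {f g : V → ℕ} {r : ℕ} (hfg : ∀ v, ∀ i < r, (f v = i ↔ g v = i)) (v : V) :
    r ≤ f v ↔ r ≤ g v := by
  have h1 := hfg v (f v)
  have h2 := hfg v (g v)
  constructor
  · intro h; by_contra! hlt; have := (h2 hlt).2 rfl; omega
  · intro h; by_contra! hlt; have := (h1 hlt).1 rfl; omega

/-- As long as some vertex can drop to a smaller color `i < r`, it does so. Each drop lowers the sum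
of `min (f v) r`, which is at most `r` per vertex. Classes below `j` never change, because every
vertex of larger color is already blocked from them. -/
theorem exists_recolorPath_greedyUpTo [Fintype V] {E : Finset (Finset V)} {q r : ℕ} (j : ℕ)
    (f : V → Fin q) (hf : IsProperColoring E f) (hj : GreedyUpTo E (fun v => f v) j) :
    ∃ f' : V → Fin q, RecolorPath E (r * Fintype.card V) f f' ∧ GreedyUpTo E (fun v => f' v) r ∧
      ∀ v, ∀ i < j, ((f v : ℕ) = i ↔ (f' v : ℕ) = i) := by
  suffices H : ∀ s, ∀ f : V → Fin q, ∑ v, min (f v : ℕ) r = s → IsProperColoring E f →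
      GreedyUpTo E (fun v => f v) j → ∃ f' : V → Fin q, RecolorPath E s f f' ∧
      GreedyUpTo E (fun v => f' v) r ∧ ∀ v, ∀ i < j, ((f v : ℕ) = i ↔ (f' v : ℕ) = i) by
    obtain ⟨f', h1, h2⟩ := H _ f rfl hf hj
    refine ⟨f', h1.mono ?_, h2⟩
    calc _ ≤ ∑ v : V, r := Finset.sum_le_sum fun v _ => min_le_right _ _
      _ = _ := by simp [mul_comm]
  intro s
  induction s using Nat.strong_induction_on with
  | _ s ih =>
    intro f hs hf hj
    by_cases hg : GreedyUpTo E (fun v => f v) r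
    · exact ⟨f, .refl _ _, hg, fun _ _ _ => Iff.rfl⟩
    unfold GreedyUpTo at hg
    push Not at hg
    obtain ⟨i, hi, v, hiv, hno⟩ := hg
    have hji : j ≤ i := by
      by_contra! hlt
      obtain ⟨e, he, hve, hu⟩ := hj i hlt v hiv
      obtain ⟨u, hue, huv, hne⟩ := hno e he hve
      exact hne (hu u hue huv)
    let c : Fin q := ⟨i, hiv.trans (f v).2⟩
    have hcc : (c : ℕ) = i := rfl
    have hval : ∀ x, (Function.update f v c x : ℕ) = if x = v then i else f x := by
      intro x
      by_cases hx : x = v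
      · subst hx; simp [hcc]
      · simp [hx]
    have hp : IsProperColoring E (Function.update f v c) := by
      rw [isProperColoring_iff] at hf ⊢
      intro e he
      by_cases hve : v ∈ e
      · obtain ⟨u, hue, huv, hne⟩ := hno e he hve
        refine ⟨u, hue, v, hve, fun h => hne ?_⟩
        rw [Function.update_of_ne huv, Function.update_self] at h
        rw [h]
      · obtain ⟨a, ha, b, hb, hab⟩ := hf e he
        refine ⟨a, ha, b, hb, ?_⟩
        rwa [Function.update_of_ne (by rintro rfl; exact hve ha),
          Function.update_of_ne (by rintro rfl; exact hve hb)]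
    have hagree : ∀ x, ∀ i' < j, ((f x : ℕ) = i' ↔ (Function.update f v c x : ℕ) = i') := by
      intro x i' hi'
      rw [hval]
      split_ifs with hx
      · subst hx
        constructor <;> intro h <;> omega
      · rfl
    have hlt : ∑ x, min (Function.update f v c x : ℕ) r < s := by
      rw [← hs]
      refine Finset.sum_lt_sum (fun x _ => ?_) ⟨v, Finset.mem_univ v, ?_⟩
      · rw [hval]
        split_ifs with hx
        · subst hx; exact min_le_min_right _ hiv.le
        · rfl
      · rw [hval, if_pos rfl]
        rw [lt_min_iff, min_lt_iff, min_lt_iff]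
        exact ⟨Or.inl hiv, Or.inl hi⟩
    obtain ⟨f', h1, h2, h3⟩ := ih _ hlt _ rfl hp (hj.congr hagree)
    refine ⟨f', ?_, h2, fun x i' hi' => (hagree x i' hi').trans (h3 x i' hi')⟩
    have h4 : RecolorPath E 1 f (Function.update f v c) := .step _ _ (.refl 0 f) hp
    exact (h4.trans h1).mono (by omega)

/-- The vertices left uncolored by `r` greedy color classes always span a degenerate hypergraph. -/
def GreedyDegenerate [Fintype V] (E : Finset (Finset V)) (r κ : ℕ) : Prop :=
  ∀ f : V → ℕ, GreedyUpTo E f r → IsDegenerate E κ (Finset.univ.filter fun v => r ≤ f v)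

theorem card_filter_fin_ge (q r : ℕ) :
    (Finset.univ.filter fun c : Fin q => r ≤ (c : ℕ)).card = q - r := by
  have h := Finset.card_map (s := Finset.univ.filter fun c : Fin q => r ≤ (c : ℕ)) Fin.valEmbedding
  rw [← h, ← Nat.card_Ico r q]
  congr 1
  ext x
  simp only [Finset.mem_map, Finset.mem_filter, Finset.mem_univ, true_and, Fin.valEmbedding_apply,
    Finset.mem_Ico]
  constructor
  · rintro ⟨a, ha, rfl⟩; exact ⟨ha, a.2⟩
  · rintro ⟨h1, h2⟩; exact ⟨⟨x, h2⟩, h1, rfl⟩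

variable [Fintype V]

/-- After a greedy reduction the color `l` occurs only on the degenerate remainder, which can be
properly colored, and hence recolored, from its palette without `l`. -/
theorem GreedyDegenerate.exists_avoiding {E : Finset (Finset V)} {q r κ : ℕ}
    (hG : GreedyDegenerate E r κ) (hE : ∀ e ∈ E, 2 ≤ e.card) (hq : r + 3 * κ + 2 ≤ q)
    (l : Fin q) (hl : (l : ℕ) = q - 1) (j : ℕ) (hjr : j ≤ r)
    (f : V → Fin q) (hf : IsProperColoring E f) (hj : GreedyUpTo E (fun v => f v) j) :
    ∃ f' : V → Fin q, RecolorPath E ((r + 3) * Fintype.card V) f f' ∧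
      (∀ v, ∀ i < j, ((f v : ℕ) = i ↔ (f' v : ℕ) = i)) ∧ ∀ v, f' v ≠ l := by
  obtain ⟨g, h1, h2, h3⟩ := exists_recolorPath_greedyUpTo (r := r) j f hf hj
  set U := Finset.univ.filter fun v => r ≤ (g v : ℕ) with hU
  have hdeg : IsDegenerate E κ U := hG _ h2
  set P := Finset.univ.filter fun c : Fin q => r ≤ (c : ℕ) with hP
  have hPc : P.card = q - r := card_filter_fin_ge q r
  have hlP : l ∈ P := Finset.mem_filter.2 ⟨Finset.mem_univ _, by omega⟩
  obtain ⟨τ, t1, t2, t3⟩ := hdeg.exists_coloring hE (P.erase l)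
    (by rw [Finset.card_erase_of_mem hlP]; omega) g
  have h4 : RecolorPath E (3 * Fintype.card V) g τ :=
    hdeg.exists_recolorPath hE P (by omega) (h1.isProperColoring hf) (by simp [hU, hP])
      (fun x hx => Finset.mem_of_mem_erase (t2 x hx)) t1 t3
  refine ⟨τ, (h1.trans h4).mono (by rw [add_mul]), ?_, ?_⟩
  · intro v i hi
    rw [h3 v i hi]
    by_cases hv : v ∈ U
    · have h5 : r ≤ (g v : ℕ) := (Finset.mem_filter.1 hv).2
      have h6 : r ≤ (τ v : ℕ) := (Finset.mem_filter.1 (Finset.mem_of_mem_erase (t2 v hv))).2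
      constructor <;> intro h <;> omega
    · rw [t1 v hv]
  · intro v
    by_cases hv : v ∈ U
    · exact (Finset.mem_erase.1 (t2 v hv)).1
    · rw [t1 v hv]
      rintro h
      refine hv (Finset.mem_filter.2 ⟨Finset.mem_univ _, ?_⟩)
      rw [h]; omega

/-- Turn the `j`-th color class into that of a greedy target coloring `T`. -/
theorem GreedyDegenerate.exists_fix_class {E : Finset (Finset V)} {q r κ : ℕ}
    (hG : GreedyDegenerate E r κ) (hE : ∀ e ∈ E, 2 ≤ e.card) (hq : r + 3 * κ + 2 ≤ q)
    (l : Fin q) (hl : (l : ℕ) = q - 1) {T : V → Fin q} (hT : IsProperColoring E T)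
    (hTg : GreedyUpTo E (fun v => T v) r) (j : ℕ) (hjr : j < r)
    (f : V → Fin q) (hf : IsProperColoring E f) (hfl : ∀ v, f v ≠ l)
    (hTf : ∀ v, ∀ i < j, ((T v : ℕ) = i ↔ (f v : ℕ) = i)) :
    ∃ f' : V → Fin q, RecolorPath E ((r + 5) * Fintype.card V) f f' ∧
      (∀ v, ∀ i < j + 1, ((T v : ℕ) = i ↔ (f' v : ℕ) = i)) ∧ ∀ v, f' v ≠ l := by
  let J : Fin q := ⟨j, by omega⟩
  have hJl : J ≠ l := fun h => by have := congrArg Fin.val h; simp only [J] at this; omega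
  set S := Finset.univ.filter fun v => T v = J with hS
  have hmemS : ∀ v, v ∈ S ↔ T v = J := by simp [hS]
  have hSE : ∀ e ∈ E, ∃ x ∈ e, x ∉ S := by
    intro e he
    obtain ⟨x, hx, y, hy, hxy⟩ := isProperColoring_iff.1 hT e he
    by_contra! hall
    exact hxy (((hmemS x).1 (hall x hx)).trans ((hmemS y).1 (hall y hy)).symm)
  set g : V → Fin q := S.piecewise (fun _ => l) f with hg
  have p1 : RecolorPath E S.card f g := recolorPath_piecewise hf hfl S hSE
  have hgp := p1.isProperColoring hf
  set π := Equiv.swap J l with hπ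
  have hgv : ∀ v, g v = if T v = J then l else f v := by
    intro v
    by_cases hv : T v = J
    · rw [hg, Finset.piecewise_eq_of_mem _ _ _ ((hmemS v).2 hv), if_pos hv]
    · rw [hg, Finset.piecewise_eq_of_notMem _ _ _ (mt (hmemS v).1 hv), if_neg hv]
  have hTg' : ∀ v, ∀ i < j + 1, ((T v : ℕ) = i ↔ ((π ∘ g) v : ℕ) = i) := by
    intro v i hi
    simp only [Function.comp_apply, hgv]
    by_cases hv : T v = J
    · rw [if_pos hv, hπ, Equiv.swap_apply_right, hv]
    · rw [if_neg hv]
      have hTj : (T v : ℕ) ≠ j := fun h => hv (Fin.ext h)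
      rcases Nat.lt_succ_iff_lt_or_eq.1 hi with hij | rfl
      · rw [hTf v i hij]
        by_cases hfJ : f v = J
        · rw [hfJ, hπ, Equiv.swap_apply_left]
          simp only [J]
          constructor <;> intro h <;> omega
        · rw [hπ, Equiv.swap_apply_of_ne_of_ne hfJ (hfl v)]
      · refine iff_of_false hTj fun h => ?_
        have h' : π (f v) = J := Fin.ext h
        rw [hπ, Equiv.swap_apply_eq_iff, Equiv.swap_apply_left] at h'
        exact hfl v h'
  -- With `J` and `l` interchanged, `g` has the same classes up to `j` as `T`, so it is greedy up to
  -- `j + 1` and the last color can be cleared without touching them. Read back through `π`, this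
  -- path starts at `g`, keeps `S` in color `l`, and frees `J`.
  obtain ⟨h, p2, hh, hhl⟩ := hG.exists_avoiding hE hq l hl (j + 1) hjr (π ∘ g)
    (hgp.perm_comp π) ((hTg.mono hjr).congr hTg')
  have p3 := p2.perm_comp π
  have hππ : π ∘ (π ∘ g) = g := by funext v; simp [hπ]
  rw [hππ] at p3
  have hhJ : ∀ v, h v = J ↔ T v = J := by
    intro v
    rw [Fin.ext_iff, Fin.ext_iff]
    exact ((hTg' v j (by omega)).trans (hh v j (by omega))).symm
  -- `h` avoids `l`, so `π ∘ h` avoids `J`, and `S` can move from `l` to its final color `J`.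
  have p4 : RecolorPath E S.card (π ∘ h) h := by
    have := recolorPath_piecewise (p3.isProperColoring hgp) (c := J) (fun v hv => ?_) S hSE
    · convert this using 1
      funext v
      by_cases hv : T v = J
      · rw [Finset.piecewise_eq_of_mem _ _ _ ((hmemS v).2 hv)]
        exact (hhJ v).2 hv
      · rw [Finset.piecewise_eq_of_notMem _ _ _ (mt (hmemS v).1 hv), Function.comp_apply, hπ,
          Equiv.swap_apply_of_ne_of_ne (mt (hhJ v).1 hv) (hhl v)]
    · rw [Function.comp_apply, hπ, Equiv.swap_apply_eq_iff, Equiv.swap_apply_left] at hv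
      exact hhl v hv
  refine ⟨h, ((p1.trans p3).trans p4).mono ?_,
    fun v i hi => (hTg' v i hi).trans (hh v i hi), hhl⟩
  have : S.card ≤ Fintype.card V := Finset.card_le_univ S
  nlinarith

/-- `T` is a greedy reduction of `τ`. From `σ`, the last color is cleared, the `r` classes of `T`
are installed in turn, and the degenerate remainder is recolored. Per vertex this costs `(r + 3) + r
(r + 5) + 3` moves. -/
theorem GreedyDegenerate.exists_common {E : Finset (Finset V)} {q r κ : ℕ}
    (hG : GreedyDegenerate E r κ) (hE : ∀ e ∈ E, 2 ≤ e.card) (hq : r + 3 * κ + 2 ≤ q)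
    {σ τ : V → Fin q} (hσ : IsProperColoring E σ) (hτ : IsProperColoring E τ) :
    ∃ T : V → Fin q, RecolorPath E ((r ^ 2 + 6 * r + 6) * Fintype.card V) σ T ∧
      RecolorPath E (r * Fintype.card V) τ T := by
  let l : Fin q := ⟨q - 1, by omega⟩
  have hl : (l : ℕ) = q - 1 := rfl
  have hg0 : ∀ f : V → ℕ, GreedyUpTo E f 0 := fun f i hi => absurd hi (Nat.not_lt_zero i)
  obtain ⟨T, t1, t2, -⟩ := exists_recolorPath_greedyUpTo (r := r) 0 τ hτ (hg0 _)
  have hT := t1.isProperColoring hτ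
  have main : ∀ j ≤ r, ∃ f : V → Fin q,
      RecolorPath E ((r + 3) * Fintype.card V + j * ((r + 5) * Fintype.card V)) σ f ∧
      (∀ v, ∀ i < j, ((T v : ℕ) = i ↔ (f v : ℕ) = i)) ∧ ∀ v, f v ≠ l := by
    intro j
    induction j with
    | zero =>
      intro _
      obtain ⟨f, h1, -, h3⟩ := hG.exists_avoiding hE hq l hl 0 (Nat.zero_le _) σ hσ (hg0 _)
      exact ⟨f, h1.mono (by omega), fun v i hi => absurd hi (Nat.not_lt_zero i), h3⟩
    | succ j ih =>
      intro hj
      obtain ⟨f, h1, h2, h3⟩ := ih (by omega)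
      obtain ⟨g, g1, g2, g3⟩ := hG.exists_fix_class hE hq l hl hT t2 j hj f
        (h1.isProperColoring hσ) h3 h2
      exact ⟨g, (h1.trans g1).mono (by rw [add_mul j]; omega), g2, g3⟩
  obtain ⟨f, f1, f2, -⟩ := main r le_rfl
  have hfp := f1.isProperColoring hσ
  have hdeg := hG _ (t2.congr f2)
  have p : RecolorPath E (3 * Fintype.card V) f T := by
    refine hdeg.exists_recolorPath hE (Finset.univ.filter fun c : Fin q => r ≤ (c : ℕ))
      (by rw [card_filter_fin_ge]; omega) hfp (by simp) ?_ ?_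
      (hT.mono (Finset.filter_subset _ _))
    · intro x hx
      have := (le_iff_of_agree f2 x).2 (Finset.mem_filter.1 hx).2
      simpa using this
    · intro x hx
      have hlt : (f x : ℕ) < r := by simpa using hx
      exact Fin.ext ((f2 x _ hlt).2 rfl)
  exact ⟨T, (f1.trans p).mono (le_of_eq (by ring)), t1⟩

/-- Connectedness includes nonemptiness of the recoloring graph. An injective coloring is proper;
its greedy reduction keeps the first `r` classes, and the degenerate remainder is colored afresh
from the other colors. -/
theorem GreedyDegenerate.exists_isProperColoring {E : Finset (Finset V)} {q r κ : ℕ}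
    (hG : GreedyDegenerate E r κ) (hE : ∀ e ∈ E, 2 ≤ e.card) (hq : r + 3 * κ + 2 ≤ q) :
    ∃ σ : V → Fin q, IsProperColoring E σ := by
  let ι : V → Fin (Fintype.card V) := Fintype.equivFin V
  have hι : IsProperColoring E ι := by
    rw [isProperColoring_iff]
    intro e he
    obtain ⟨x, hx, y, hy, hxy⟩ := Finset.one_lt_card.1 (hE e he)
    exact ⟨x, hx, y, hy, fun h => hxy ((Fintype.equivFin V).injective h)⟩
  obtain ⟨f, p, hf, -⟩ := exists_recolorPath_greedyUpTo (r := r) 0 ι hι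
    (fun i hi => absurd hi (Nat.not_lt_zero i))
  have hfp := p.isProperColoring hι
  have hdeg := hG _ hf
  obtain ⟨τ, t1, t2, t3⟩ := hdeg.exists_coloring hE
    (Finset.univ.filter fun c : Fin q => r ≤ (c : ℕ)) (by rw [card_filter_fin_ge]; omega)
    -- The default color is never seen: a vertex with `q ≤ f v` lies in the remainder and is
    -- overwritten.
    (fun v => if h : (f v : ℕ) < q then ⟨f v, h⟩ else ⟨0, by omega⟩)
  have hU : ∀ v, v ∈ (Finset.univ.filter fun v => r ≤ (f v : ℕ)) ↔ r ≤ (f v : ℕ) := by simp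
  have hoff : ∀ v, (f v : ℕ) < r → (τ v : ℕ) = f v := by
    intro v hv
    rw [t1 v (by rw [hU]; omega), dif_pos (by omega)]
  have hon : ∀ v, r ≤ (f v : ℕ) → r ≤ (τ v : ℕ) := by
    intro v hv
    simpa using t2 v ((hU v).2 hv)
  refine ⟨τ, isProperColoring_iff.2 fun e he => ?_⟩
  by_cases heU : ∀ x ∈ e, r ≤ (f x : ℕ)
  · exact isProperColoring_iff.1 t3 e (Finset.mem_filter.2 ⟨he, fun x hx => (hU x).2 (heU x hx)⟩)
  · push Not at heU
    obtain ⟨w, hwe, hw⟩ := heU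
    by_cases hy : ∃ y ∈ e, r ≤ (f y : ℕ)
    · obtain ⟨y, hye, hy⟩ := hy
      refine ⟨y, hye, w, hwe, fun h => ?_⟩
      have h1 := hon y hy
      have h2 := hoff w hw
      rw [h] at h1
      omega
    · push Not at hy
      obtain ⟨a, ha, b, hb, hab⟩ := isProperColoring_iff.1 hfp e he
      refine ⟨a, ha, b, hb, fun h => hab (Fin.ext ?_)⟩
      rw [← hoff a (hy a ha), ← hoff b (hy b hb), h]

end Greedy

/-! ### From recoloring paths to distances in the recoloring graph -/

section RecoloringGraph

theorem RecolorPath.edist_le {n q : ℕ} {E : Finset (Finset (Fin n))} {N : ℕ} {σ τ : Fin n → Fin q}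
    (h : RecolorPath E N σ τ) (hσ : IsProperColoring E σ) (hτ : IsProperColoring E τ) :
    (recoloringGraph E q).edist ⟨σ, hσ⟩ ⟨τ, hτ⟩ ≤ N := by
  induction h with
  | refl N σ => simp
  | @step N σ τ v c h hp ih =>
    have hτ' := h.isProperColoring hσ
    by_cases hc : τ v = c
    · subst hc
      simp only [Function.update_eq_self]
      exact (ih hσ hτ').trans (by exact_mod_cast Nat.le_succ N)
    · refine (SimpleGraph.edist_triangle (v := ⟨τ, hτ'⟩)).trans ?_
      push_cast
      refine add_le_add (ih hσ hτ') ?_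
      have hadj : (recoloringGraph E q).Adj ⟨τ, hτ'⟩ ⟨Function.update τ v c, hτ⟩ := by
        change hammingDist τ (Function.update τ v c) = 1
        rw [hammingDist, Finset.card_eq_one]
        refine ⟨v, ?_⟩
        ext x
        by_cases hx : x = v
        · subst hx; simp [hc]
        · simp [hx]
      exact (SimpleGraph.edist_eq_one_iff_adj.2 hadj).le

theorem GreedyDegenerate.connected_and_ediam_le {n q r κ : ℕ} {E : Finset (Finset (Fin n))}
    (hG : GreedyDegenerate E r κ) (hE : ∀ e ∈ E, 2 ≤ e.card) (hq : r + 3 * κ + 2 ≤ q) :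
    (recoloringGraph E q).Connected ∧
      (recoloringGraph E q).ediam ≤ (((r ^ 2 + 7 * r + 6) * n : ℕ) : ℕ∞) := by
  have key : ∀ x y, (recoloringGraph E q).edist x y ≤ (((r ^ 2 + 7 * r + 6) * n : ℕ) : ℕ∞) := by
    rintro ⟨σ, hσ⟩ ⟨τ, hτ⟩
    obtain ⟨T, p1, p2⟩ := hG.exists_common hE hq hσ hτ
    have hT := p2.isProperColoring hτ
    refine (SimpleGraph.edist_triangle (v := ⟨T, hT⟩)).trans ?_
    refine (add_le_add (p1.edist_le hσ hT)
      (SimpleGraph.edist_comm.trans_le (p2.edist_le hτ hT))).trans ?_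
    rw [Fintype.card_fin, ← Nat.cast_add]
    exact_mod_cast le_of_eq (by ring)
  obtain ⟨σ, hσ⟩ := hG.exists_isProperColoring hE hq
  refine ⟨?_, ?_⟩
  · have : Nonempty {σ : Fin n → Fin q // IsProperColoring E σ} := ⟨⟨σ, hσ⟩⟩
    refine SimpleGraph.Connected.mk fun x y => ?_
    exact SimpleGraph.reachable_of_edist_ne_top
      (ne_top_of_le_ne_top (ENat.natCast_ne_top _) (key x y))
  · exact SimpleGraph.ediam_le_of_edist_le key

end RecoloringGraph

/-! ### Greedy windows and density imply `GreedyDegenerate` -/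

section Stages

variable {V : Type*} [DecidableEq V] [Fintype V]

/-- Every vertex of `S` carrying the last label has, for each other label `i`, an edge whose
remaining vertices lie in `S` and carry the label `i`. -/
def Saturated {r : ℕ} (E : Finset (Finset V)) (S : Finset V) (f : V → Fin (r + 1)) : Prop :=
  ∀ v ∈ S, f v = Fin.last r → ∀ i : Fin r,
    ∃ e ∈ E, v ∈ e ∧ ∀ x ∈ e, x ≠ v → x ∈ S ∧ f x = i.castSucc

/-- Some set of `w` vertices contains `r` classes that block at least `u` further vertices. -/
def HasSaturated (E : Finset (Finset V)) (w u r : ℕ) : Prop :=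
  ∃ S : Finset V, S.card = w ∧ ∃ f : V → Fin (r + 1),
    u ≤ (S.filter fun v => f v = Fin.last r).card ∧ Saturated E S f

/-- Take the vertices of color at least `j`, pad them to exactly `w` vertices, and label by `f - j`
capped at `r`. Greediness is saturation for this labelling. Padding vertices receive label `0`,
which is not the last label because `r > 0`. -/
theorem GreedyUpTo.card_lt_of_not_hasSaturated {E : Finset (Finset V)} {f : V → ℕ}
    {J j w u r : ℕ} (hf : GreedyUpTo E f J) (hJ : j + r ≤ J) (hr : 0 < r)
    (hw : (Finset.univ.filter fun v => j ≤ f v).card ≤ w) (hwV : w ≤ Fintype.card V)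
    (h : ¬ HasSaturated E w u r) : (Finset.univ.filter fun v => j + r ≤ f v).card < u := by
  by_contra! hu
  obtain ⟨S, hS, -, hSc⟩ := Finset.exists_subsuperset_card_eq
    (Finset.subset_univ (Finset.univ.filter fun v => j ≤ f v)) hw hwV
  have hmem : ∀ v, j ≤ f v → v ∈ S := fun v hv => hS (by simpa using hv)
  let g : V → Fin (r + 1) := fun v => ⟨if j ≤ f v then min (f v - j) r else 0, by
    split_ifs <;> omega⟩
  have hg : ∀ v, (g v : ℕ) = if j ≤ f v then min (f v - j) r else 0 := fun v => rfl
  have hlast : ∀ v, g v = Fin.last r ↔ j + r ≤ f v := by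
    intro v
    rw [Fin.ext_iff, hg, Fin.val_last]
    split_ifs <;> omega
  refine h ⟨S, hSc, g, hu.trans (Finset.card_le_card ?_), ?_⟩
  · intro v hv
    have hv' : j + r ≤ f v := by simpa using hv
    exact Finset.mem_filter.2 ⟨hmem v (by omega), (hlast v).2 hv'⟩
  · intro v _ hv i
    rw [hlast] at hv
    obtain ⟨e, he, hve, hu⟩ := hf (j + i) (by omega) v (by omega)
    refine ⟨e, he, hve, fun x hx hxv => ?_⟩
    have hfx := hu x hx hxv
    refine ⟨hmem x (by omega), ?_⟩
    rw [Fin.ext_iff, hg, Fin.val_castSucc, if_pos (by omega)]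
    omega

/-- Some nonempty set `W` of at most `s` vertices spans at least `κ |W|` edges. -/
def HasDense (E : Finset (Finset V)) (s κ : ℕ) : Prop :=
  ∃ W : Finset V, W.Nonempty ∧ W.card ≤ s ∧ κ * W.card ≤ (edgesWithin E W).card

/-- Double counting of incidences: if all degrees inside `W` exceed `k * κ`, the `k`-uniform
hypergraph on `W` has at least `κ |W|` edges. -/
theorem isDegenerate_of_not_hasDense {E : Finset (Finset V)} {s κ k : ℕ} {U : Finset V}
    (hE : ∀ e ∈ E, e.card = k) (h : ¬ HasDense E s κ) (hU : U.card ≤ s) :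
    IsDegenerate E (k * κ) U := by
  intro W hW hne
  by_contra! hdeg
  refine h ⟨W, hne, (Finset.card_le_card hW).trans hU, ?_⟩
  have h1 : ∑ v ∈ W, (E.filter fun e => v ∈ e ∧ e ⊆ W).card = k * (edgesWithin E W).card := by
    have h2 : ∀ v ∈ W, (E.filter fun e => v ∈ e ∧ e ⊆ W).card =
        ((edgesWithin E W).filter fun e => v ∈ e).card := by
      intro v _
      rw [edgesWithin, Finset.filter_filter]
      simp only [and_comm]
    rw [Finset.sum_congr rfl h2]
    have h3 := Finset.sum_card_bipartiteAbove_eq_sum_card_bipartiteBelow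
      (s := W) (t := edgesWithin E W) (fun v e => v ∈ e)
    simp only [Finset.bipartiteAbove, Finset.bipartiteBelow] at h3
    rw [h3, Finset.sum_congr rfl (g := fun _ => k), Finset.sum_const, smul_eq_mul, mul_comm]
    intro e he
    obtain ⟨heE, heW⟩ := Finset.mem_filter.1 he
    rw [← hE e heE]
    congr 1
    ext x
    simpa using fun hx => heW hx
  have h4 : ∑ v ∈ W, k * κ ≤ ∑ v ∈ W, (E.filter fun e => v ∈ e ∧ e ⊆ W).card :=
    Finset.sum_le_sum fun v hv => (hdeg v hv).le
  rw [h1, Finset.sum_const, smul_eq_mul] at h4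
  rcases Nat.eq_zero_or_pos k with rfl | hk
  · obtain ⟨v, hv⟩ := hne
    obtain ⟨e, he⟩ := Finset.card_pos.1 ((Nat.zero_le _).trans_lt (hdeg v hv))
    obtain ⟨heE, hve, -⟩ := Finset.mem_filter.1 he
    have := hE e heE
    rw [Finset.card_eq_zero] at this
    simp [this] at hve
  · refine Nat.le_of_mul_le_mul_left ?_ hk
    calc k * (κ * W.card) = W.card * (k * κ) := by ring
      _ ≤ _ := h4

theorem greedyDegenerate_of_stages {E : Finset (Finset V)} {k κ w₁ w₂ w₃ r₀ r₁ r₂ : ℕ}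
    (hE : ∀ e ∈ E, e.card = k) (hr₀ : 0 < r₀) (hr₁ : 0 < r₁) (hr₂ : 0 < r₂)
    (hw₁ : w₁ ≤ Fintype.card V) (hw₂ : w₂ ≤ Fintype.card V)
    (h₀ : ¬ HasSaturated E (Fintype.card V) (w₁ + 1) r₀) (h₁ : ¬ HasSaturated E w₁ (w₂ + 1) r₁)
    (h₂ : ¬ HasSaturated E w₂ (w₃ + 1) r₂) (hd : ¬ HasDense E w₃ κ) :
    GreedyDegenerate E (r₀ + r₁ + r₂) (k * κ) := by
  intro f hf
  have s₀ := hf.card_lt_of_not_hasSaturated (j := 0) (by omega) hr₀ (Finset.card_le_univ _)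
    le_rfl h₀
  have s₁ := hf.card_lt_of_not_hasSaturated (j := 0 + r₀) (by omega) hr₁ (Nat.lt_succ_iff.1 s₀)
    hw₁ h₁
  have s₂ := hf.card_lt_of_not_hasSaturated (j := 0 + r₀ + r₁) (by omega) hr₂
    (Nat.lt_succ_iff.1 s₁) hw₂ h₂
  rw [zero_add] at s₂
  exact isDegenerate_of_not_hasDense hE hd (Nat.lt_succ_iff.1 s₂)

end Stages

/-! ### Binomial random subsets and comparison with uniform ones -/

section Binomial

variable {α : Type*} [DecidableEq α]

/-- The probability of the set `A` under the binomial random subset of `X`. -/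
def binomialWeight (p : ℝ) (X A : Finset α) : ℝ := p ^ A.card * (1 - p) ^ (X.card - A.card)

theorem binomialWeight_nonneg {p : ℝ} (h0 : 0 ≤ p) (h1 : p ≤ 1) (X A : Finset α) :
    0 ≤ binomialWeight p X A := mul_nonneg (pow_nonneg h0 _) (pow_nonneg (by linarith) _)

theorem sum_binomialWeight (p : ℝ) (X : Finset α) :
    ∑ A ∈ X.powerset, binomialWeight p X A = 1 := by
  simp [binomialWeight, Finset.sum_pow_mul_eq_add_pow]

theorem binomialWeight_split (p : ℝ) {X F A : Finset α} (hF : F ⊆ X) (hA : A ⊆ X) :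
    binomialWeight p X A = binomialWeight p (X \ F) (A \ F) * binomialWeight p F (A ∩ F) := by
  have h1 : (A \ F).card + (A ∩ F).card = A.card := Finset.card_sdiff_add_card_inter A F
  have h2 : (X \ F).card + F.card = X.card := Finset.card_sdiff_add_card_eq_card hF
  have h3 : (A \ F).card ≤ (X \ F).card := Finset.card_le_card (Finset.sdiff_subset_sdiff hA le_rfl)
  have h4 : (A ∩ F).card ≤ F.card := Finset.card_le_card Finset.inter_subset_right
  have h5 : X.card - A.card = ((X \ F).card - (A \ F).card) + (F.card - (A ∩ F).card) := by omega
  unfold binomialWeight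
  rw [h5, ← h1, pow_add, pow_add]
  ring

/-- Hitting pairwise disjoint sets are independent events. The induction splits `A` into its parts
inside and outside one of the sets, over which the weight factorizes. -/
theorem sum_binomialWeight_hits_le {ι : Type*} [DecidableEq ι] {p : ℝ} (h0 : 0 ≤ p) (h1 : p ≤ 1)
    (F : ι → Finset α) (s : Finset ι) (X : Finset α) (hF : ∀ i ∈ s, F i ⊆ X)
    (hdisj : ∀ i ∈ s, ∀ j ∈ s, i ≠ j → Disjoint (F i) (F j)) :
    ∑ A ∈ X.powerset.filter (fun A => ∀ i ∈ s, (A ∩ F i).Nonempty), binomialWeight p X A ≤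
      ∏ i ∈ s, (1 - (1 - p) ^ (F i).card) := by
  induction s using Finset.induction_on generalizing X with
  | empty => simp [sum_binomialWeight]
  | insert j s hj ih =>
    have hFj : F j ⊆ X := hF j (by simp)
    have hne : ∀ i ∈ s, j ≠ i := fun i hi h => hj (h ▸ hi)
    have hd : ∀ i ∈ s, Disjoint (F j) (F i) := fun i hi =>
      hdisj j (by simp) i (by simp [hi]) (hne i hi)
    have ih' := ih (X \ F j) (fun i hi => Finset.subset_sdiff.2
      ⟨hF i (by simp [hi]), (hd i hi).symm⟩)
      (fun i hi i' hi' h => hdisj i (by simp [hi]) i' (by simp [hi']) h)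
    have hlast : ∑ A ∈ (F j).powerset.erase ∅, binomialWeight p (F j) A =
        1 - (1 - p) ^ (F j).card := by
      have h := Finset.add_sum_erase _ (binomialWeight p (F j)) (Finset.empty_mem_powerset (F j))
      have h' : binomialWeight p (F j) ∅ = (1 - p) ^ (F j).card := by simp [binomialWeight]
      rw [sum_binomialWeight, h'] at h
      linarith
    rw [Finset.prod_insert hj, mul_comm, ← hlast]
    have hpos : 0 ≤ ∑ A ∈ (F j).powerset.erase ∅, binomialWeight p (F j) A :=
      Finset.sum_nonneg fun A _ => binomialWeight_nonneg h0 h1 _ _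
    refine le_trans ?_ (mul_le_mul_of_nonneg_right ih' hpos)
    rw [Finset.sum_mul_sum, ← Finset.sum_product']
    set Q := (X.powerset.filter fun A => ∀ i ∈ insert j s, (A ∩ F i).Nonempty) with hQ
    set R := ((X \ F j).powerset.filter fun A => ∀ i ∈ s, (A ∩ F i).Nonempty) ×ˢ
      (F j).powerset.erase ∅ with hR
    have hinj : Set.InjOn (fun A : Finset α => (A \ F j, A ∩ F j)) Q := by
      intro A _ B _ hAB
      simp only [Prod.mk.injEq] at hAB
      rw [← Finset.sdiff_union_inter A (F j), ← Finset.sdiff_union_inter B (F j), hAB.1, hAB.2]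
    have hmap : Q.image (fun A : Finset α => (A \ F j, A ∩ F j)) ⊆ R := by
      intro x hx
      obtain ⟨A, hA, rfl⟩ := Finset.mem_image.1 hx
      obtain ⟨hAX, hAs⟩ := Finset.mem_filter.1 hA
      rw [Finset.mem_powerset] at hAX
      refine Finset.mem_product.2 ⟨Finset.mem_filter.2 ⟨Finset.mem_powerset.2
        (Finset.sdiff_subset_sdiff hAX le_rfl), fun i hi => ?_⟩, Finset.mem_erase.2
        ⟨(hAs j (by simp)).ne_empty, Finset.mem_powerset.2 Finset.inter_subset_right⟩⟩
      obtain ⟨x, hx⟩ := hAs i (by simp [hi])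
      obtain ⟨hxA, hxF⟩ := Finset.mem_inter.1 hx
      exact ⟨x, Finset.mem_inter.2 ⟨Finset.mem_sdiff.2 ⟨hxA, fun hxj =>
        Finset.disjoint_left.1 (hd i hi) hxj hxF⟩, hxF⟩⟩
    calc ∑ A ∈ Q, binomialWeight p X A
        = ∑ A ∈ Q, binomialWeight p (X \ F j) (A \ F j) * binomialWeight p (F j) (A ∩ F j) :=
          Finset.sum_congr rfl fun A hA => binomialWeight_split p hFj
            (Finset.mem_powerset.1 (Finset.mem_filter.1 hA).1)
      _ = ∑ x ∈ Q.image (fun A : Finset α => (A \ F j, A ∩ F j)),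
            binomialWeight p (X \ F j) x.1 * binomialWeight p (F j) x.2 :=
          (Finset.sum_image (f := fun x : Finset α × Finset α =>
            binomialWeight p (X \ F j) x.1 * binomialWeight p (F j) x.2) hinj).symm
      _ ≤ _ := Finset.sum_le_sum_of_subset_of_nonneg hmap fun x _ _ =>
          mul_nonneg (binomialWeight_nonneg h0 h1 _ _) (binomialWeight_nonneg h0 h1 _ _)

/-- The term `m` of the binomial expansion of `(m + (N - m)) ^ N` is the largest one. -/
theorem binomial_term_le {N m : ℕ} (hm : m ≤ N) (j : ℕ) (hj : j ≤ N) :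
    m ^ j * (N - m) ^ (N - j) * N.choose j ≤ m ^ m * (N - m) ^ (N - m) * N.choose m := by
  obtain ⟨b, rfl⟩ := Nat.exists_eq_add_of_le hm
  rw [Nat.add_sub_cancel_left]
  have hchoose : ∀ j, (m + b).choose (j + 1) * (j + 1) = (m + b).choose j * (m + b - j) :=
    fun j => Nat.choose_succ_right_eq _ _
  have up : ∀ t, t ≤ m → m ^ (m - t) * b ^ (m + b - (m - t)) * (m + b).choose (m - t) ≤
      m ^ m * b ^ b * (m + b).choose m := by
    intro t
    induction t with
    | zero => intro _; simp
    | succ t ih =>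
      intro ht
      refine le_trans ?_ (ih (by omega))
      obtain ⟨i, hi⟩ : ∃ i, m = i + (t + 1) := ⟨m - (t + 1), by omega⟩
      have e1 : m - (t + 1) = i := by omega
      have e2 : m - t = i + 1 := by omega
      have e3 : m + b - (m - (t + 1)) = (b + t) + 1 := by omega
      have e4 : m + b - (m - t) = b + t := by omega
      rw [e3, e4, e1, e2, pow_succ, pow_succ]
      have hc := hchoose i
      have key : b * (m + b).choose i ≤ m * (m + b).choose (i + 1) := by
        refine Nat.le_of_mul_le_mul_left (c := i + 1) ?_ (Nat.succ_pos i)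
        calc (i + 1) * (b * (m + b).choose i) = (m + b).choose i * ((i + 1) * b) := by ring
          _ ≤ (m + b).choose i * (m * (m + b - i)) := by
              gcongr <;> omega
          _ = m * ((m + b).choose i * (m + b - i)) := by ring
          _ = (i + 1) * (m * (m + b).choose (i + 1)) := by rw [← hc]; ring
      calc m ^ i * (b ^ (b + t) * b) * (m + b).choose i
          = m ^ i * b ^ (b + t) * (b * (m + b).choose i) := by ring
        _ ≤ m ^ i * b ^ (b + t) * (m * (m + b).choose (i + 1)) := by gcongr
        _ = _ := by ring
  have down : ∀ t, t ≤ b → m ^ (m + t) * b ^ (m + b - (m + t)) * (m + b).choose (m + t) ≤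
      m ^ m * b ^ b * (m + b).choose m := by
    intro t
    induction t with
    | zero => intro _; simp
    | succ t ih =>
      intro ht
      refine le_trans ?_ (ih (by omega))
      have e1 : m + b - (m + (t + 1)) = b - (t + 1) := by omega
      have e2 : m + b - (m + t) = (b - (t + 1)) + 1 := by omega
      have hc := hchoose (m + t)
      rw [e1, e2, pow_succ, ← add_assoc, pow_succ]
      have key : m * (m + b).choose (m + t + 1) ≤ b * (m + b).choose (m + t) := by
        refine Nat.le_of_mul_le_mul_left (c := m + t + 1) ?_ (Nat.succ_pos _)
        calc (m + t + 1) * (m * (m + b).choose (m + t + 1))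
            = m * ((m + b).choose (m + t + 1) * (m + t + 1)) := by ring
          _ = (m + b).choose (m + t) * (m * (m + b - (m + t))) := by rw [hc]; ring
          _ ≤ (m + b).choose (m + t) * ((m + t + 1) * b) := by
              gcongr <;> omega
          _ = _ := by ring
      calc m ^ (m + t) * m * b ^ (b - (t + 1)) * (m + b).choose (m + t + 1)
          = m ^ (m + t) * b ^ (b - (t + 1)) * (m * (m + b).choose (m + t + 1)) := by ring
        _ ≤ m ^ (m + t) * b ^ (b - (t + 1)) * (b * (m + b).choose (m + t)) := by gcongr
        _ = _ := by ring
  rcases le_total j m with h | h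
  · simpa [Nat.sub_sub_self h] using up (m - j) (Nat.sub_le _ _)
  · simpa [Nat.add_sub_cancel' h] using down (j - m) (by omega)

/-- The `N + 1` binomial probabilities with parameter `m / N` add up to one, and the one at `m` is
the largest. -/
theorem one_le_succ_mul_binomial_mode {N m : ℕ} (hm : m ≤ N) (hN : 0 < N) :
    (1 : ℝ) ≤ (N + 1) * (N.choose m * ((m / N : ℝ) ^ m * (1 - m / N : ℝ) ^ (N - m))) := by
  have hN' : (0 : ℝ) < N := by exact_mod_cast hN
  have h1 : N ^ N ≤ (N + 1) * (m ^ m * (N - m) ^ (N - m) * N.choose m) := by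
    calc N ^ N = (m + (N - m)) ^ N := by rw [Nat.add_sub_cancel' hm]
      _ = ∑ j ∈ Finset.range (N + 1), m ^ j * (N - m) ^ (N - j) * N.choose j := add_pow _ _ _
      _ ≤ ∑ j ∈ Finset.range (N + 1), m ^ m * (N - m) ^ (N - m) * N.choose m :=
          Finset.sum_le_sum fun j hj => binomial_term_le hm j (Nat.lt_succ_iff.1
            (Finset.mem_range.1 hj))
      _ = _ := by simp
  have h2 : (N : ℝ) ^ N ≤ (N + 1) * ((m : ℝ) ^ m * (N - m : ℝ) ^ (N - m) * N.choose m) := by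
    have h3 : ((N - m : ℕ) : ℝ) = N - m := Nat.cast_sub hm
    rw [← h3]
    exact_mod_cast h1
  have h4 : (1 - m / N : ℝ) = (N - m) / N := by field_simp
  have h5 : (N : ℝ) ^ N = (N : ℝ) ^ m * (N : ℝ) ^ (N - m) := by
    rw [← pow_add, Nat.add_sub_cancel' hm]
  rw [h4, div_pow, div_pow]
  calc (1 : ℝ) = (N : ℝ) ^ N / (N : ℝ) ^ N := (div_self (by positivity)).symm
    _ ≤ (N + 1) * ((m : ℝ) ^ m * (N - m : ℝ) ^ (N - m) * N.choose m) / (N : ℝ) ^ N := by gcongr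
    _ = _ := by rw [h5]; field_simp

/-- A uniformly random `m`-subset is controlled by the binomial random subset. -/
theorem card_filter_powersetCard_le {X : Finset α} {m : ℕ} (hm : m ≤ X.card) (hX : 0 < X.card)
    (Q : Finset α → Prop) [DecidablePred Q] :
    (((X.powersetCard m).filter Q).card : ℝ) ≤ (X.card + 1) * X.card.choose m *
      ∑ A ∈ X.powerset.filter Q, binomialWeight (m / X.card) X A := by
  set p : ℝ := m / X.card with hp
  have hX' : (0 : ℝ) < X.card := by exact_mod_cast hX
  have h0 : 0 ≤ p := by positivity
  have h1 : p ≤ 1 := by rw [hp, div_le_one hX']; exact_mod_cast hm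
  have hsub : (X.powersetCard m).filter Q ⊆ X.powerset.filter Q :=
    Finset.filter_subset_filter _ fun A hA =>
      Finset.mem_powerset.2 (Finset.mem_powersetCard.1 hA).1
  have h2 : (((X.powersetCard m).filter Q).card : ℝ) * (p ^ m * (1 - p) ^ (X.card - m)) ≤
      ∑ A ∈ X.powerset.filter Q, binomialWeight p X A := by
    refine le_trans (le_of_eq ?_) (Finset.sum_le_sum_of_subset_of_nonneg hsub
      fun A _ _ => binomialWeight_nonneg h0 h1 X A)
    rw [Finset.sum_congr rfl (g := fun _ => p ^ m * (1 - p) ^ (X.card - m))]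
    · simp
    · intro A hA
      rw [binomialWeight, (Finset.mem_powersetCard.1 (Finset.mem_filter.1 hA).1).2]
  have h3 := one_le_succ_mul_binomial_mode hm hX
  rw [← hp] at h3
  calc (((X.powersetCard m).filter Q).card : ℝ)
      ≤ ((X.powersetCard m).filter Q).card * ((X.card + 1) * (X.card.choose m *
          (p ^ m * (1 - p) ^ (X.card - m)))) := le_mul_of_one_le_right (by positivity) h3
    _ = (X.card + 1) * X.card.choose m * (((X.powersetCard m).filter Q).card *
          (p ^ m * (1 - p) ^ (X.card - m))) := by ring
    _ ≤ _ := by gcongr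

/-- The chance that a uniform `m`-subset contains `j` given elements is a product of factors `(m -
i) / (N - i) ≤ m / N`; denominators are cleared here. -/
theorem pow_mul_choose_sub_le (N m j : ℕ) (hj : j ≤ m) (hm : m ≤ N) :
    N ^ j * (N - j).choose (m - j) ≤ m ^ j * N.choose m := by
  induction j generalizing N m with
  | zero => simp
  | succ j ih =>
    obtain ⟨m, rfl⟩ : ∃ m', m = m' + 1 := ⟨m - 1, by omega⟩
    obtain ⟨N, rfl⟩ : ∃ N', N = N' + 1 := ⟨N - 1, by omega⟩
    rw [Nat.add_sub_add_right, Nat.add_sub_add_right]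
    have h := ih N m (by omega) (by omega)
    have hsucc := Nat.add_one_mul_choose_eq N m
    rcases Nat.eq_zero_or_pos N with rfl | hN
    · obtain rfl : m = 0 := by omega
      simp
    -- compare `(N+1)^j m^j` with `(m+1)^j N^j`
    have hcmp : (N + 1) ^ j * m ^ j ≤ (m + 1) ^ j * N ^ j := by
      rw [← mul_pow, ← mul_pow]
      exact Nat.pow_le_pow_left (by nlinarith) j
    refine Nat.le_of_mul_le_mul_left (c := N ^ j) ?_ (by positivity)
    calc N ^ j * ((N + 1) ^ (j + 1) * (N - j).choose (m - j))
        = (N + 1) ^ (j + 1) * (N ^ j * (N - j).choose (m - j)) := by ring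
      _ ≤ (N + 1) ^ (j + 1) * (m ^ j * N.choose m) := by gcongr
      _ = ((N + 1) ^ j * m ^ j) * ((N + 1) * N.choose m) := by ring
      _ ≤ ((m + 1) ^ j * N ^ j) * ((N + 1) * N.choose m) := by gcongr
      _ = N ^ j * ((m + 1) ^ j * ((N + 1) * N.choose m)) := by ring
      _ = _ := by rw [hsucc]; ring

theorem card_filter_superset_le {X F : Finset α} {m : ℕ} (hF : F ⊆ X) (hm : m ≤ X.card)
    (hX : 0 < X.card) :
    (((X.powersetCard m).filter (F ⊆ ·)).card : ℝ) ≤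
      (m / X.card : ℝ) ^ F.card * X.card.choose m := by
  have hX' : (0 : ℝ) < X.card := by exact_mod_cast hX
  have hcard : ((X.powersetCard m).filter (F ⊆ ·)).card ≤ ((X \ F).powersetCard (m - F.card)).card := by
    refine Finset.card_le_card_of_injOn (fun A => A \ F) ?_ ?_
    · intro A hA
      obtain ⟨hA, hFA⟩ := Finset.mem_filter.1 hA
      obtain ⟨hAX, hAc⟩ := Finset.mem_powersetCard.1 hA
      exact Finset.mem_powersetCard.2 ⟨Finset.sdiff_subset_sdiff hAX le_rfl,
        by rw [Finset.card_sdiff_of_subset hFA, hAc]⟩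
    · intro A hA B hB hAB
      have hA' := (Finset.mem_filter.1 hA).2
      have hB' := (Finset.mem_filter.1 hB).2
      simp only at hAB
      rw [← Finset.sdiff_union_of_subset hA', ← Finset.sdiff_union_of_subset hB', hAB]
  by_cases hFm : F.card ≤ m
  · rw [Finset.card_powersetCard, Finset.card_sdiff_of_subset hF] at hcard
    refine (Nat.cast_le.2 hcard).trans ?_
    have h := pow_mul_choose_sub_le X.card m F.card hFm hm
    have h' : (X.card : ℝ) ^ F.card * ((X.card - F.card).choose (m - F.card) : ℕ) ≤
        (m : ℝ) ^ F.card * (X.card.choose m : ℕ) := by exact_mod_cast h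
    rw [div_pow, div_mul_eq_mul_div, le_div_iff₀ (by positivity)]
    linarith
  · have : (X.powersetCard m).filter (F ⊆ ·) = ∅ := by
      refine Finset.filter_eq_empty_iff.2 fun A hA hFA => hFm ?_
      rw [← (Finset.mem_powersetCard.1 hA).2]
      exact Finset.card_le_card hFA
    rw [this]
    simp only [Finset.card_empty, Nat.cast_zero]
    positivity

end Binomial

/-! ### Union bounds for saturated and dense sets -/

section Probability

variable {n m k : ℕ}

theorem card_uniformHypergraphs (n m k : ℕ) :
    (uniformHypergraphs n m k).card = (n.choose k).choose m := by
  simp [uniformHypergraphs]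

theorem card_of_mem_uniformHypergraphs {E : Finset (Finset (Fin n))}
    (hE : E ∈ uniformHypergraphs n m k) : ∀ e ∈ E, e.card = k := fun _ he =>
  (Finset.mem_powersetCard.1 ((Finset.mem_powersetCard.1 hE).1 he)).2

theorem randomHypergraphProb_eq (P : Finset (Finset (Fin n)) → Prop) [DecidablePred P] :
    randomHypergraphProb n m k P =
      ((uniformHypergraphs n m k).filter P).card / (uniformHypergraphs n m k).card := by
  unfold randomHypergraphProb
  congr!

theorem randomHypergraphProb_mono {P Q : Finset (Finset (Fin n)) → Prop}
    (h : ∀ E ∈ uniformHypergraphs n m k, P E → Q E) :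
    randomHypergraphProb n m k P ≤ randomHypergraphProb n m k Q := by
  classical
  simp only [randomHypergraphProb_eq]
  gcongr ?_ / _
  refine Nat.cast_le.2 (Finset.card_le_card fun E hE => ?_)
  obtain ⟨h1, h2⟩ := Finset.mem_filter.1 hE
  exact Finset.mem_filter.2 ⟨h1, h E h1 h2⟩

theorem randomHypergraphProb_exists_le {ι : Type*} (s : Finset ι)
    (P : ι → Finset (Finset (Fin n)) → Prop) :
    randomHypergraphProb n m k (fun E => ∃ i ∈ s, P i E) ≤
      ∑ i ∈ s, randomHypergraphProb n m k (P i) := by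
  classical
  simp only [randomHypergraphProb_eq]
  rw [← Finset.sum_div]
  gcongr ?_ / _
  rw [← Nat.cast_sum]
  refine Nat.cast_le.2 (le_trans (Finset.card_le_card ?_) Finset.card_biUnion_le)
  intro E hE
  obtain ⟨h1, i, hi, h2⟩ := Finset.mem_filter.1 hE
  exact Finset.mem_biUnion.2 ⟨i, hi, Finset.mem_filter.2 ⟨h1, h2⟩⟩

theorem randomHypergraphProb_or_le (P Q : Finset (Finset (Fin n)) → Prop) :
    randomHypergraphProb n m k (fun E => P E ∨ Q E) ≤
      randomHypergraphProb n m k P + randomHypergraphProb n m k Q := by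
  have h := randomHypergraphProb_exists_le (n := n) (m := m) (k := k) Finset.univ
    (fun b : Bool => if b then P else Q)
  simp only [Finset.mem_univ, true_and, Fintype.sum_bool, if_true] at h
  refine le_trans (randomHypergraphProb_mono fun E _ hE => ?_) h
  rcases hE with hE | hE
  · exact ⟨true, by simpa using hE⟩
  · exact ⟨false, by simpa using hE⟩

theorem one_sub_le_randomHypergraphProb (hm : m ≤ n.choose k)
    {P Q : Finset (Finset (Fin n)) → Prop}
    (h : ∀ E ∈ uniformHypergraphs n m k, ¬ Q E → P E) :
    1 - randomHypergraphProb n m k Q ≤ randomHypergraphProb n m k P := by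
  classical
  have h1 := randomHypergraphProb_or_le (n := n) (m := m) (k := k) P Q
  have h2 : randomHypergraphProb n m k (fun E => P E ∨ Q E) = 1 := by
    rw [randomHypergraphProb_eq, Finset.filter_true_of_mem (fun E hE => or_iff_not_imp_right.2 (h E hE))]
    refine div_self ?_
    rw [card_uniformHypergraphs]
    exact_mod_cast (Nat.choose_pos hm).ne'
  linarith

theorem randomHypergraphProb_le_one (P : Finset (Finset (Fin n)) → Prop) :
    randomHypergraphProb n m k P ≤ 1 := by
  classical
  unfold randomHypergraphProb
  refine div_le_one_of_le₀ ?_ (by positivity)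
  exact_mod_cast Finset.card_filter_le _ _

theorem randomHypergraphProb_hits_le {ι : Type*} [DecidableEq ι] (hm : m ≤ n.choose k)
    (hk : k ≤ n) (F : ι → Finset (Finset (Fin n))) (s : Finset ι)
    (hF : ∀ i ∈ s, ∀ e ∈ F i, e.card = k)
    (hdisj : ∀ i ∈ s, ∀ j ∈ s, i ≠ j → Disjoint (F i) (F j)) :
    randomHypergraphProb n m k (fun E => ∀ i ∈ s, (E ∩ F i).Nonempty) ≤
      (n.choose k + 1) * ∏ i ∈ s, (1 - (1 - m / n.choose k : ℝ) ^ (F i).card) := by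
  classical
  set X : Finset (Finset (Fin n)) := Finset.powersetCard k Finset.univ with hX
  have hXc : X.card = n.choose k := by simp [hX]
  have hpos : 0 < n.choose k := Nat.choose_pos hk
  have h1 := card_filter_powersetCard_le (X := X) (m := m) (by rwa [hXc]) (by rwa [hXc])
    (fun E => ∀ i ∈ s, (E ∩ F i).Nonempty)
  have h2 := sum_binomialWeight_hits_le (p := (m / X.card : ℝ)) (by positivity)
    (div_le_one_of_le₀ (by rw [hXc]; exact_mod_cast hm) (by positivity)) F s X
    (fun i hi e he => Finset.mem_powersetCard.2 ⟨Finset.subset_univ _, hF i hi e he⟩) hdisj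
  have h3 := h1.trans (mul_le_mul_of_nonneg_left h2 (by positivity))
  rw [hXc] at h3
  rw [randomHypergraphProb_eq, card_uniformHypergraphs]
  have hpos' : (0 : ℝ) < (n.choose k).choose m := by exact_mod_cast Nat.choose_pos hm
  rw [div_le_iff₀ hpos']
  have h4 : (n.choose k + 1 : ℝ) * (∏ i ∈ s, (1 - (1 - m / n.choose k : ℝ) ^ (F i).card)) *
      (n.choose k).choose m = (n.choose k + 1 : ℝ) * (n.choose k).choose m *
        ∏ i ∈ s, (1 - (1 - m / n.choose k : ℝ) ^ (F i).card) := by ring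
  rw [h4]
  exact h3

theorem randomHypergraphProb_superset_le (hm : m ≤ n.choose k) (hk : k ≤ n)
    (F : Finset (Finset (Fin n))) (hF : ∀ e ∈ F, e.card = k) :
    randomHypergraphProb n m k (F ⊆ ·) ≤ (m / n.choose k : ℝ) ^ F.card := by
  classical
  set X : Finset (Finset (Fin n)) := Finset.powersetCard k Finset.univ with hX
  have hXc : X.card = n.choose k := by simp [hX]
  have h1 := card_filter_superset_le (X := X) (m := m) (F := F)
    (fun e he => Finset.mem_powersetCard.2 ⟨Finset.subset_univ _, hF e he⟩) (by rwa [hXc])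
    (by rw [hXc]; exact Nat.choose_pos hk)
  rw [hXc] at h1
  rw [randomHypergraphProb_eq, card_uniformHypergraphs]
  have hpos' : (0 : ℝ) < (n.choose k).choose m := by exact_mod_cast Nat.choose_pos hm
  rw [div_le_iff₀ hpos']
  exact h1

/-- The `k`-sets consisting of `v` and `k - 1` vertices of `S` labelled `i`. -/
def blockingEdges {r : ℕ} (k : ℕ) (S : Finset (Fin n)) (f : Fin n → Fin (r + 1))
    (x : Fin n × Fin r) : Finset (Finset (Fin n)) :=
  ((S.filter fun v => f v = x.2.castSucc).powersetCard (k - 1)).image (insert x.1)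

theorem mem_blockingEdges {r : ℕ} {S : Finset (Fin n)} {f : Fin n → Fin (r + 1)}
    {x : Fin n × Fin r} (hx : f x.1 = Fin.last r) (hk : 1 ≤ k) {e : Finset (Fin n)} :
    e ∈ blockingEdges k S f x ↔
      e.card = k ∧ x.1 ∈ e ∧ ∀ y ∈ e, y ≠ x.1 → y ∈ S ∧ f y = x.2.castSucc := by
  have hne : ∀ y, f y = x.2.castSucc → y ≠ x.1 := by
    rintro y hy rfl
    exact (Fin.castSucc_lt_last x.2).ne (hy.symm.trans hx)
  simp only [blockingEdges, Finset.mem_image, Finset.mem_powersetCard]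
  constructor
  · rintro ⟨T, ⟨hT, hTc⟩, rfl⟩
    have hxT : x.1 ∉ T := fun h => hne _ (Finset.mem_filter.1 (hT h)).2 rfl
    refine ⟨by rw [Finset.card_insert_of_notMem hxT, hTc]; omega, by simp, ?_⟩
    intro y hy hyx
    exact Finset.mem_filter.1 (hT ((Finset.mem_insert.1 hy).resolve_left hyx))
  · rintro ⟨hc, hxe, hy⟩
    refine ⟨e.erase x.1, ⟨?_, by rw [Finset.card_erase_of_mem hxe, hc]⟩,
      Finset.insert_erase hxe⟩
    intro y hye
    obtain ⟨hyx, hye⟩ := Finset.mem_erase.1 hye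
    exact Finset.mem_filter.2 (hy y hye hyx)

theorem card_blockingEdges {r : ℕ} {S : Finset (Fin n)} {f : Fin n → Fin (r + 1)}
    {x : Fin n × Fin r} (hx : f x.1 = Fin.last r) :
    (blockingEdges k S f x).card =
      (S.filter fun v => f v = x.2.castSucc).card.choose (k - 1) := by
  rw [blockingEdges, Finset.card_image_of_injOn, Finset.card_powersetCard]
  intro A hA B hB hAB
  have hnot : ∀ T ∈ (S.filter fun v => f v = x.2.castSucc).powersetCard (k - 1), x.1 ∉ T := by
    intro T hT h
    have := (Finset.mem_filter.1 ((Finset.mem_powersetCard.1 hT).1 h)).2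
    exact (Fin.castSucc_lt_last x.2).ne (this.symm.trans hx)
  have hAB' : insert x.1 A = insert x.1 B := hAB
  rw [← Finset.erase_insert (hnot A hA), hAB', Finset.erase_insert (hnot B hB)]

/-- An edge blocking `v` from `i` determines both: `v` is its only vertex with the last label, and
since `k ≥ 2` another vertex reveals `i`. The blocking families are therefore disjoint, and the
product bound for hitting applies. -/
theorem randomHypergraphProb_saturated_le {r : ℕ} (hm : m ≤ n.choose k) (hk : k ≤ n) (hk2 : 2 ≤ k)
    (S : Finset (Fin n)) (f : Fin n → Fin (r + 1)) :
    randomHypergraphProb n m k (fun E => Saturated E S f) ≤ (n.choose k + 1) *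
      Real.exp (-((S.filter fun v => f v = Fin.last r).card * ∑ i : Fin r,
        (1 - m / n.choose k : ℝ) ^ (S.filter fun v => f v = i.castSucc).card.choose (k - 1))) := by
  classical
  set U := S.filter fun v => f v = Fin.last r with hU
  set s : Finset (Fin n × Fin r) := U ×ˢ Finset.univ with hs
  have hlast : ∀ x ∈ s, f x.1 = Fin.last r := fun x hx =>
    (Finset.mem_filter.1 (Finset.mem_product.1 hx).1).2
  have hp1 : (m / n.choose k : ℝ) ≤ 1 := div_le_one_of_le₀ (by exact_mod_cast hm) (by positivity)
  have h1 : randomHypergraphProb n m k (fun E => Saturated E S f) ≤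
      randomHypergraphProb n m k (fun E => ∀ x ∈ s, (E ∩ blockingEdges k S f x).Nonempty) := by
    refine randomHypergraphProb_mono fun E hE hsat x hx => ?_
    obtain ⟨hxS, hxl⟩ := Finset.mem_filter.1 (Finset.mem_product.1 hx).1
    obtain ⟨e, he, hxe, hy⟩ := hsat x.1 hxS hxl x.2
    exact ⟨e, Finset.mem_inter.2 ⟨he, (mem_blockingEdges hxl (by omega)).2
      ⟨card_of_mem_uniformHypergraphs hE e he, hxe, hy⟩⟩⟩
  have hdisj : ∀ x ∈ s, ∀ y ∈ s, x ≠ y →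
      Disjoint (blockingEdges k S f x) (blockingEdges k S f y) := by
    intro x hx y hy hxy
    refine Finset.disjoint_left.2 fun e hex hey => hxy ?_
    obtain ⟨hc, hxe, hx'⟩ := (mem_blockingEdges (hlast x hx) (by omega)).1 hex
    obtain ⟨-, hye, hy'⟩ := (mem_blockingEdges (hlast y hy) (by omega)).1 hey
    have e1 : x.1 = y.1 := by
      by_contra hne
      exact (Fin.castSucc_lt_last y.2).ne (((hy' x.1 hxe hne).2).symm.trans (hlast x hx))
    obtain ⟨z, hz, hzx⟩ := Finset.exists_mem_ne (s := e) (by omega) x.1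
    refine Prod.ext e1 (Fin.castSucc_injective r ?_)
    rw [← (hx' z hz hzx).2, (hy' z hz (by rwa [← e1])).2]
  refine (h1.trans (randomHypergraphProb_hits_le hm hk _ s
    (fun x hx e he => ((mem_blockingEdges (hlast x hx) (by omega)).1 he).1) hdisj)).trans ?_
  gcongr
  calc ∏ x ∈ s, (1 - (1 - m / n.choose k : ℝ) ^ (blockingEdges k S f x).card)
      ≤ ∏ x ∈ s, Real.exp (-(1 - m / n.choose k : ℝ) ^
          (S.filter fun v => f v = x.2.castSucc).card.choose (k - 1)) := by
        refine Finset.prod_le_prod (fun x _ => ?_) fun x hx => ?_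
        · exact sub_nonneg.2 (pow_le_one₀ (sub_nonneg.2 hp1) (by
            have : (0 : ℝ) ≤ m / n.choose k := by positivity
            linarith))
        · rw [card_blockingEdges (hlast x hx)]
          exact Real.one_sub_le_exp_neg _
    _ = _ := by
        rw [← Real.exp_sum, hs, Finset.sum_product]
        simp [Finset.sum_neg_distrib]

/-- At least a `1 / (l + 1)` fraction of the classes exceed the average by a factor of at most
`1 + 1 / l`. -/
theorem sum_ge_of_average {r : ℕ} (hr : 0 < r) {l w y : ℝ} (hl : 0 < l) (hw : 0 ≤ w)
    (c : Fin r → ℕ) (hc : ∑ i, (c i : ℝ) ≤ w) (g : ℕ → ℝ) (hg0 : ∀ t, 0 ≤ g t)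
    (hg : ∀ t : ℕ, (t : ℝ) ≤ (1 + 1 / l) * w / r → y ≤ g t) (hy : 0 ≤ y) :
    r / (l + 1) * y ≤ ∑ i, g (c i) := by
  classical
  set G := Finset.univ.filter fun i : Fin r => (c i : ℝ) ≤ (1 + 1 / l) * w / r with hG
  have hr' : (0 : ℝ) < r := by exact_mod_cast hr
  have hcard : (r : ℝ) / (l + 1) ≤ G.card := by
    rcases hw.eq_or_lt with rfl | hw
    · have hall : G = Finset.univ := by
        refine Finset.filter_true_of_mem fun i _ => ?_
        have h1 : (c i : ℝ) ≤ ∑ i, (c i : ℝ) :=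
          Finset.single_le_sum (f := fun i => (c i : ℝ)) (fun _ _ => by positivity)
            (Finset.mem_univ i)
        simpa using h1.trans hc
      rw [hall, Finset.card_univ, Fintype.card_fin]
      exact div_le_self hr'.le (by linarith)
    · have hcompl : (Finset.univ.filter fun i : Fin r => ¬ (c i : ℝ) ≤ (1 + 1 / l) * w / r).card +
          G.card = r := by
        rw [add_comm, hG, Finset.card_filter_add_card_filter_not]
        simp
      set B := Finset.univ.filter fun i : Fin r => ¬ (c i : ℝ) ≤ (1 + 1 / l) * w / r
      have h1 : B.card * ((1 + 1 / l) * w / r) ≤ w := by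
        refine le_trans ?_ hc
        calc B.card * ((1 + 1 / l) * w / r) = ∑ i ∈ B, ((1 + 1 / l) * w / r) := by simp
          _ ≤ ∑ i ∈ B, (c i : ℝ) := Finset.sum_le_sum fun i hi =>
              (not_le.1 (Finset.mem_filter.1 hi).2).le
          _ ≤ _ := Finset.sum_le_sum_of_subset_of_nonneg (Finset.subset_univ _)
              fun _ _ _ => by positivity
      have h2 : (B.card : ℝ) * (l + 1) ≤ r * l := by
        have h3 : B.card * ((1 + 1 / l) * w / r) = (B.card * (l + 1)) * (w / (l * r)) := by
          field_simp
        have h4 : w = (r * l) * (w / (l * r)) := by field_simp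
        rw [h3] at h1
        nth_rewrite 2 [h4] at h1
        exact le_of_mul_le_mul_right h1 (by positivity)
      have h5 : (B.card : ℝ) + G.card = r := by exact_mod_cast hcompl
      rw [div_le_iff₀ (by linarith)]
      nlinarith
  calc r / (l + 1) * y ≤ G.card * y := by gcongr
    _ = ∑ i ∈ G, y := by simp
    _ ≤ ∑ i ∈ G, g (c i) := Finset.sum_le_sum fun i hi => hg _ (Finset.mem_filter.1 hi).2
    _ ≤ _ := Finset.sum_le_sum_of_subset_of_nonneg (Finset.subset_univ _) fun _ _ _ => hg0 _

theorem randomHypergraphProb_hasSaturated_le {r w u : ℕ} (hm : m ≤ n.choose k) (hk : k ≤ n)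
    (hk2 : 2 ≤ k) (hr : 0 < r) {l y : ℝ} (hl : 0 < l) (hy : 0 ≤ y)
    (hmiss : ∀ t : ℕ, (t : ℝ) ≤ (1 + 1 / l) * w / r →
      y ≤ (1 - m / n.choose k : ℝ) ^ t.choose (k - 1)) :
    randomHypergraphProb n m k (fun E => HasSaturated E w u r) ≤
      (n.choose w : ℝ) * (r + 1) ^ w * ((n.choose k + 1) *
        Real.exp (-(u * (r / (l + 1) * y)))) := by
  classical
  have hp1 : (m / n.choose k : ℝ) ≤ 1 := div_le_one_of_le₀ (by exact_mod_cast hm) (by positivity)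
  -- Labels outside `S` are irrelevant; freezing them leaves `(r + 1) ^ w` labellings in the union
  -- bound instead of `(r + 1) ^ n`.
  let fs : Finset (Fin n) → Finset (Fin n → Fin (r + 1)) := fun S =>
    Fintype.piFinset fun v => if v ∈ S then Finset.univ else {Fin.last r}
  have hfs : ∀ S : Finset (Fin n), (fs S).card = (r + 1) ^ S.card := by
    intro S
    rw [Fintype.card_piFinset]
    have : ∀ v, (if v ∈ S then (Finset.univ : Finset (Fin (r + 1))) else {Fin.last r}).card =
        if v ∈ S then r + 1 else 1 := by
      intro v; split_ifs <;> simp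
    simp_rw [this]
    rw [Finset.prod_ite]
    simp
  set I := (Finset.powersetCard w (Finset.univ : Finset (Fin n))).sigma fs with hI
  set Q : ((_ : Finset (Fin n)) × (Fin n → Fin (r + 1))) → Finset (Finset (Fin n)) → Prop :=
    fun x E => u ≤ (x.1.filter fun v => x.2 v = Fin.last r).card ∧ Saturated E x.1 x.2 with hQ
  have h1 : randomHypergraphProb n m k (fun E => HasSaturated E w u r) ≤
      randomHypergraphProb n m k (fun E => ∃ x ∈ I, Q x E) := by
    refine randomHypergraphProb_mono fun E _ ⟨S, hS, f, hu, hf⟩ => ?_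
    have hg : ∀ v ∈ S, S.piecewise f (fun _ => Fin.last r) v = f v := fun v hv =>
      Finset.piecewise_eq_of_mem _ _ _ hv
    refine ⟨⟨S, S.piecewise f fun _ => Fin.last r⟩, ?_, ?_, ?_⟩
    · refine Finset.mem_sigma.2 ⟨Finset.mem_powersetCard.2 ⟨Finset.subset_univ _, hS⟩, ?_⟩
      refine Fintype.mem_piFinset.2 fun v => ?_
      by_cases hv : v ∈ S <;> simp [hv]
    · refine hu.trans (Finset.card_le_card fun v hv => ?_)
      obtain ⟨hv, hvl⟩ := Finset.mem_filter.1 hv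
      exact Finset.mem_filter.2 ⟨hv, (hg v hv).trans hvl⟩
    · intro v hv hvl i
      obtain ⟨e, he, hve, hx⟩ := hf v hv ((hg v hv).symm.trans hvl) i
      refine ⟨e, he, hve, fun x hxe hxv => ?_⟩
      obtain ⟨hxS, hfx⟩ := hx x hxe hxv
      exact ⟨hxS, (hg x hxS).trans hfx⟩
  have h2 : ∀ x ∈ I, randomHypergraphProb n m k (Q x) ≤
      (n.choose k + 1) * Real.exp (-(u * (r / (l + 1) * y))) := by
    rintro ⟨S, f⟩ hx
    obtain ⟨hS, -⟩ := Finset.mem_sigma.1 hx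
    have hSc : S.card = w := (Finset.mem_powersetCard.1 hS).2
    by_cases hu : u ≤ (S.filter fun v => f v = Fin.last r).card
    · refine (randomHypergraphProb_mono fun E _ hE => hE.2).trans
        ((randomHypergraphProb_saturated_le hm hk hk2 S f).trans ?_)
      have hsum : ∑ i : Fin r, ((S.filter fun v => f v = i.castSucc).card : ℝ) ≤ w := by
        rw [← hSc]
        have h3 : ∑ i : Fin r, (S.filter fun v => f v = i.castSucc).card ≤ S.card := by
          rw [← Finset.card_biUnion]
          · exact Finset.card_le_card (Finset.biUnion_subset.2 fun _ _ => Finset.filter_subset _ _)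
          · intro i _ j _ hij
            refine Finset.disjoint_left.2 fun v hvi hvj => hij (Fin.castSucc_injective r ?_)
            rw [← (Finset.mem_filter.1 hvi).2, (Finset.mem_filter.1 hvj).2]
        exact_mod_cast h3
      have h4 := sum_ge_of_average hr hl (Nat.cast_nonneg w) _ hsum
        (fun t => (1 - m / n.choose k : ℝ) ^ t.choose (k - 1))
        (fun t => pow_nonneg (sub_nonneg.2 hp1) _) hmiss hy
      gcongr
    · have h0 : randomHypergraphProb n m k (Q ⟨S, f⟩) = 0 := by
        rw [randomHypergraphProb_eq, Finset.filter_false_of_mem fun E _ hE => hu hE.1]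
        simp
      rw [h0]
      positivity
  calc _ ≤ ∑ x ∈ I, randomHypergraphProb n m k (Q x) :=
        h1.trans (randomHypergraphProb_exists_le I Q)
    _ ≤ ∑ x ∈ I, (n.choose k + 1) * Real.exp (-(u * (r / (l + 1) * y))) := Finset.sum_le_sum h2
    _ = I.card * ((n.choose k + 1) * Real.exp (-(u * (r / (l + 1) * y)))) := by simp
    _ = _ := by
      congr 1
      rw [hI, Finset.card_sigma, Finset.sum_congr rfl (g := fun _ => (r + 1) ^ w)]
      · simp
      · intro S hS
        rw [hfs, (Finset.mem_powersetCard.1 hS).2]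

theorem randomHypergraphProb_hasDense_le {s κ : ℕ} (hm : m ≤ n.choose k) (hk : k ≤ n) :
    randomHypergraphProb n m k (fun E => HasDense E s κ) ≤
      ∑ w ∈ Finset.Icc 1 s, (n.choose w : ℝ) * ((w.choose k).choose (κ * w) *
        (m / n.choose k : ℝ) ^ (κ * w)) := by
  classical
  let I : ℕ → Finset ((_ : Finset (Fin n)) × Finset (Finset (Fin n))) := fun w =>
    (Finset.powersetCard w (Finset.univ : Finset (Fin n))).sigma fun W =>
      (Finset.powersetCard k W).powersetCard (κ * w)
  have h1 : randomHypergraphProb n m k (fun E => HasDense E s κ) ≤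
      randomHypergraphProb n m k (fun E => ∃ w ∈ Finset.Icc 1 s, ∃ x ∈ I w, x.2 ⊆ E) := by
    refine randomHypergraphProb_mono fun E hE ⟨W, hne, hWs, hW⟩ => ?_
    obtain ⟨F, hF, hFc⟩ := Finset.exists_subset_card_eq hW
    refine ⟨W.card, Finset.mem_Icc.2 ⟨hne.card_pos, hWs⟩, ⟨W, F⟩, ?_,
      hF.trans (Finset.filter_subset _ _)⟩
    refine Finset.mem_sigma.2 ⟨Finset.mem_powersetCard.2 ⟨Finset.subset_univ _, rfl⟩,
      Finset.mem_powersetCard.2 ⟨fun e he => ?_, hFc⟩⟩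
    obtain ⟨heE, heW⟩ := Finset.mem_filter.1 (hF he)
    exact Finset.mem_powersetCard.2 ⟨heW, card_of_mem_uniformHypergraphs hE e heE⟩
  refine (h1.trans (randomHypergraphProb_exists_le _ _)).trans (Finset.sum_le_sum fun w _ => ?_)
  refine (randomHypergraphProb_exists_le (I w) (fun x E => x.2 ⊆ E)).trans ?_
  have h2 : ∀ x ∈ I w, randomHypergraphProb n m k (fun E => x.2 ⊆ E) ≤
      (m / n.choose k : ℝ) ^ (κ * w) := by
    intro x hx
    obtain ⟨-, hx2⟩ := Finset.mem_sigma.1 hx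
    obtain ⟨hxs, hxc⟩ := Finset.mem_powersetCard.1 hx2
    rw [← hxc]
    exact randomHypergraphProb_superset_le hm hk x.2 fun e he =>
      (Finset.mem_powersetCard.1 (hxs he)).2
  refine (Finset.sum_le_sum h2).trans (le_of_eq ?_)
  have hIc : (I w).card = n.choose w * (w.choose k).choose (κ * w) := by
    rw [Finset.card_sigma, Finset.sum_congr rfl (g := fun _ => (w.choose k).choose (κ * w))]
    · simp
    · intro W hW
      rw [Finset.card_powersetCard, Finset.card_powersetCard, (Finset.mem_powersetCard.1 hW).2]
  rw [Finset.sum_const, hIc, nsmul_eq_mul]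
  push_cast
  ring

end Probability

/-! ### Asymptotic estimates for the bad events -/

section Estimates

/-- The left side is a single term in the expansion of `(ω + 1) ^ n`. -/
theorem choose_mul_pow_le {n w : ℕ} {ω : ℝ} (hω : 0 ≤ ω) :
    (n.choose w : ℝ) * ω ^ w ≤ Real.exp (ω * n) := by
  calc (n.choose w : ℝ) * ω ^ w ≤ (ω + 1) ^ n := by
        rcases le_or_gt w n with hw | hw
        · rw [add_pow]
          refine le_trans (le_of_eq ?_) (Finset.single_le_sum
            (f := fun j => ω ^ j * 1 ^ (n - j) * (n.choose j : ℝ)) (fun _ _ => by positivity)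
            (Finset.mem_range.2 (Nat.lt_succ_iff.2 hw)))
          simp [mul_comm]
        · rw [Nat.choose_eq_zero_of_lt hw]
          simp only [Nat.cast_zero, zero_mul]
          positivity
    _ ≤ (Real.exp ω) ^ n := by
        gcongr
        exact Real.add_one_le_exp ω
    _ = _ := by rw [← Real.exp_nat_mul, mul_comm]

theorem choose_le_exp {n w : ℕ} {ω : ℝ} (hω : 0 < ω) (hω1 : ω ≤ 1) (hw : (w : ℝ) ≤ ω * n) :
    (n.choose w : ℝ) ≤ Real.exp (ω * n * (1 + Real.log (1 / ω))) := by
  have h1 := choose_mul_pow_le (n := n) (w := w) hω.le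
  have hlog : 0 ≤ Real.log (1 / ω) := Real.log_nonneg (by rw [le_div_iff₀ hω]; linarith)
  have h2 : (ω ^ w)⁻¹ = Real.exp (w * Real.log (1 / ω)) := by
    rw [Real.exp_nat_mul, Real.exp_log (by positivity), one_div, inv_pow]
  calc (n.choose w : ℝ) = n.choose w * ω ^ w * (ω ^ w)⁻¹ := by field_simp
    _ ≤ Real.exp (ω * n) * Real.exp (ω * n * Real.log (1 / ω)) := by
        rw [h2]
        gcongr
    _ = _ := by rw [← Real.exp_add]; ring_nf

theorem choose_le_exp_mul_div_pow {a b : ℕ} (hb : 0 < b) :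
    (a.choose b : ℝ) ≤ (Real.exp 1 * a / b) ^ b := by
  rcases Nat.eq_zero_or_pos a with rfl | ha
  · rw [Nat.choose_eq_zero_of_lt hb]
    simp only [Nat.cast_zero]
    positivity
  have ha' : (0 : ℝ) < a := by exact_mod_cast ha
  have hb' : (0 : ℝ) < b := by exact_mod_cast hb
  have h1 := choose_mul_pow_le (n := a) (w := b) (ω := (b / a : ℝ)) (by positivity)
  have h2 : (b / a : ℝ) * a = b := by field_simp
  rw [h2] at h1
  have h3 : (Real.exp 1 * a / b : ℝ) ^ b = Real.exp b * ((b / a : ℝ) ^ b)⁻¹ := by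
    rw [← inv_pow, ← mul_one (b : ℝ), Real.exp_nat_mul, ← mul_pow, mul_one]
    congr 1
    field_simp
  rw [h3, ← div_eq_mul_inv, le_div_iff₀ (by positivity)]
  exact h1

theorem choose_div_choose_le {n w k : ℕ} (hw : w ≤ n) (hk : k ≤ n) :
    (w.choose k : ℝ) / n.choose k ≤ (w / n : ℝ) ^ k := by
  have hNk : (0 : ℝ) < n.choose k := by exact_mod_cast Nat.choose_pos hk
  rcases lt_or_ge w k with hlt | hle
  · rw [Nat.choose_eq_zero_of_lt hlt]
    simp only [Nat.cast_zero, zero_div]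
    positivity
  rcases Nat.eq_zero_or_pos n with rfl | hn
  · obtain rfl : k = 0 := by omega
    simp
  have hn' : (0 : ℝ) < n := by exact_mod_cast hn
  have h1 := pow_mul_choose_sub_le n w k hle hw
  have h2 : n.choose w * w.choose k = n.choose k * (n - k).choose (w - k) := Nat.choose_mul hle
  have hNw : (0 : ℝ) < n.choose w := by exact_mod_cast Nat.choose_pos hw
  have h1' : (n : ℝ) ^ k * (n - k).choose (w - k) ≤ (w : ℝ) ^ k * n.choose w := by exact_mod_cast h1
  have h2' : (n.choose w : ℝ) * w.choose k = n.choose k * (n - k).choose (w - k) := by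
    exact_mod_cast h2
  rw [div_pow, div_le_div_iff₀ hNk (by positivity)]
  refine le_of_mul_le_mul_left ?_ hNw
  calc (n.choose w : ℝ) * (w.choose k * (n : ℝ) ^ k)
      = n.choose k * ((n : ℝ) ^ k * (n - k).choose (w - k)) := by rw [← mul_assoc, h2']; ring
    _ ≤ n.choose k * ((w : ℝ) ^ k * n.choose w) := by gcongr
    _ = _ := by ring

theorem exp_neg_le_one_sub_pow {p : ℝ} (hp : p < 1) (t : ℕ) :
    Real.exp (-(p / (1 - p) * t)) ≤ (1 - p) ^ t := by
  have h1 := Real.one_sub_inv_le_log_of_pos (sub_pos.2 hp)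
  have h2 : 1 - (1 - p)⁻¹ = -(p / (1 - p)) := by
    have : 1 - p ≠ 0 := (sub_pos.2 hp).ne'
    field_simp
    ring
  rw [h2] at h1
  calc Real.exp (-(p / (1 - p) * t)) = Real.exp (-(p / (1 - p))) ^ t := by
        rw [← Real.exp_nat_mul]; ring_nf
    _ ≤ Real.exp (Real.log (1 - p)) ^ t := by gcongr
    _ = _ := by rw [Real.exp_log (sub_pos.2 hp)]

theorem edge_density_le {n k : ℕ} (hk : 1 ≤ k) (hn : k ≤ n) {d : ℝ} (hd : 0 ≤ d) :
    (⌊d * n / k⌋₊ / n.choose k : ℝ) ≤ d * (k - 1).factorial / ((n + 1 - k : ℕ) : ℝ) ^ (k - 1) := by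
  have hN : (0 : ℝ) < n.choose k := by exact_mod_cast Nat.choose_pos hn
  have hk' : (0 : ℝ) < k := by exact_mod_cast hk
  have hn' : (0 : ℝ) < n := by exact_mod_cast (by omega : 0 < n)
  have hnk : (0 : ℝ) < ((n + 1 - k : ℕ) : ℝ) := by exact_mod_cast (by omega : 0 < n + 1 - k)
  have h1 : (⌊d * n / k⌋₊ : ℝ) ≤ d * n / k := Nat.floor_le (by positivity)
  have h2 : (n : ℝ) * (n - 1).choose (k - 1) = n.choose k * k := by
    have := Nat.add_one_mul_choose_eq (n - 1) (k - 1)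
    rw [Nat.sub_add_cancel (by omega), Nat.sub_add_cancel hk] at this
    exact_mod_cast this
  have h3 : ((n + 1 - k : ℕ) : ℝ) ^ (k - 1) / (k - 1).factorial ≤ (n - 1).choose (k - 1) := by
    have := Nat.pow_le_choose (α := ℝ) (k - 1) (n - 1)
    rwa [show n - 1 + 1 - (k - 1) = n + 1 - k by omega] at this
  rw [div_le_div_iff₀ hN (by positivity)]
  rw [div_le_iff₀ (by positivity)] at h3
  calc (⌊d * n / k⌋₊ : ℝ) * ((n + 1 - k : ℕ) : ℝ) ^ (k - 1)
      ≤ d * n / k * ((n - 1).choose (k - 1) * (k - 1).factorial) := by gcongr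
    _ = d / k * (k - 1).factorial * (n * (n - 1).choose (k - 1)) := by ring
    _ = _ := by rw [h2]; field_simp

/-- The edge density is at most about `d (k-1)! / n^(k-1)`, and the `(k-1)!` cancels against
`t.choose (k - 1)`. The error factor depends on `n` and `D` only, so one threshold for `n` serves
all `d ≤ D` and all class sizes `t`. -/
theorem eventually_exp_neg_le_miss {k : ℕ} (hk : 2 ≤ k) {D η : ℝ} (hη : 0 < η) :
    ∀ᶠ n : ℕ in atTop, k ≤ n ∧ 0 < n ∧ ∀ d : ℝ, 0 ≤ d → d ≤ D →
      ⌊d * n / k⌋₊ ≤ n.choose k ∧ ∀ t : ℕ,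
        Real.exp (-((1 + η) * d * (t / n : ℝ) ^ (k - 1))) ≤
          (1 - ⌊d * n / k⌋₊ / n.choose k : ℝ) ^ t.choose (k - 1) := by
  have hsub : Tendsto (fun n : ℕ => ((n + 1 - k : ℕ) : ℝ)) atTop atTop :=
    tendsto_natCast_atTop_atTop.comp (tendsto_atTop_mono (fun n => (by omega : n - k ≤ n + 1 - k))
      (tendsto_sub_atTop_nat k))
  have hP : Tendsto (fun n : ℕ => D * (k - 1).factorial / ((n + 1 - k : ℕ) : ℝ) ^ (k - 1))
      atTop (𝓝 0) :=
    Tendsto.const_div_atTop ((tendsto_pow_atTop (by omega)).comp hsub) _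
  have ha : Tendsto (fun n : ℕ => (n / ((n + 1 - k : ℕ) : ℝ))) atTop (𝓝 1) := by
    have h1 : Tendsto (fun n : ℕ => 1 + ((k : ℝ) - 1) / ((n + 1 - k : ℕ) : ℝ)) atTop (𝓝 (1 + 0)) :=
      tendsto_const_nhds.add (Tendsto.const_div_atTop hsub _)
    rw [add_zero] at h1
    refine h1.congr' ?_
    filter_upwards [eventually_ge_atTop k] with n hn
    have hpos : (0 : ℝ) < ((n + 1 - k : ℕ) : ℝ) := by exact_mod_cast (by omega : 0 < n + 1 - k)
    have : ((n + 1 - k : ℕ) : ℝ) = n + 1 - k := by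
      rw [Nat.cast_sub (by omega)]; push_cast; ring
    field_simp
    rw [this]; ring
  have hlim : Tendsto (fun n : ℕ => (n / ((n + 1 - k : ℕ) : ℝ)) ^ (k - 1) /
      (1 - D * (k - 1).factorial / ((n + 1 - k : ℕ) : ℝ) ^ (k - 1))) atTop (𝓝 (1 ^ (k - 1) / (1 - 0))) :=
    (ha.pow _).div (tendsto_const_nhds.sub hP) (by norm_num)
  have hev := hlim.eventually_lt_const (u := 1 + η) (by simpa using hη)
  filter_upwards [hev, hP.eventually_lt_const (u := 1) one_pos, eventually_ge_atTop k] with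
    n h1 h2 hn
  refine ⟨hn, by omega, fun d hd hdD => ?_⟩
  set p : ℝ := ⌊d * n / k⌋₊ / n.choose k with hp
  have hN : (0 : ℝ) < n.choose k := by exact_mod_cast Nat.choose_pos hn
  have hn' : (0 : ℝ) < n := by exact_mod_cast (by omega : 0 < n)
  have hnk : (0 : ℝ) < ((n + 1 - k : ℕ) : ℝ) := by exact_mod_cast (by omega : 0 < n + 1 - k)
  have hp0 : 0 ≤ p := by positivity
  have hpd := edge_density_le (by omega : 1 ≤ k) hn hd
  rw [← hp] at hpd
  set P : ℝ := D * (k - 1).factorial / ((n + 1 - k : ℕ) : ℝ) ^ (k - 1) with hPdef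
  have hpP : p ≤ P := hpd.trans (by rw [hPdef]; gcongr)
  have hp1 : p < 1 := hpP.trans_lt h2
  refine ⟨?_, fun t => ?_⟩
  · rw [hp, div_lt_one hN] at hp1
    exact_mod_cast hp1.le
  refine le_trans (Real.exp_le_exp.2 (neg_le_neg ?_)) (exp_neg_le_one_sub_pow hp1 _)
  have h3 : (t.choose (k - 1) : ℝ) ≤ (t : ℝ) ^ (k - 1) / (k - 1).factorial :=
    Nat.choose_le_pow_div (k - 1) t
  calc p / (1 - p) * t.choose (k - 1)
      ≤ (d * (k - 1).factorial / ((n + 1 - k : ℕ) : ℝ) ^ (k - 1)) / (1 - P) *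
          ((t : ℝ) ^ (k - 1) / (k - 1).factorial) := by
        have : 0 < 1 - P := by linarith
        gcongr
    _ = d * (t / n : ℝ) ^ (k - 1) * ((n / ((n + 1 - k : ℕ) : ℝ)) ^ (k - 1) / (1 - P)) := by
        have : 1 - P ≠ 0 := by linarith
        rw [div_pow, div_pow]
        field_simp
    _ ≤ d * (t / n : ℝ) ^ (k - 1) * (1 + η) := by gcongr
    _ = _ := by ring

/-- The trade-off between entropy and blocking probability that makes a saturated stage unlikely. -/
def StageCondition (k : ℕ) (d l ω ω' : ℝ) (r : ℕ) : Prop :=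
  ω * (2 + Real.log (1 / ω) + Real.log (r + 1)) ≤
    ω' * (r / (l + 1) * Real.exp (-((1 + 1 / l) ^ k * d * (ω / r) ^ (k - 1))))

/-- In `StageCondition`, `1 + log (1/ω)` pays for the choice of the set and `log (r + 1)` for its
labels; the remaining `1` becomes the decay `exp (-(ω n))`. In the factor `(1 + 1/l)^k`, one power
comes from the edge density and `k - 1` from the averaging over classes. -/
theorem randomHypergraphProb_hasSaturated_le_exp {n m k r : ℕ} (hm : m ≤ n.choose k) (hk : k ≤ n)
    (hk2 : 2 ≤ k) (hr : 0 < r) (hn : 0 < n) {d l ω ω' : ℝ} (hd : 0 ≤ d) (hl : 0 < l) (hω : 0 < ω)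
    (hω1 : ω ≤ 1)
    (hmiss : ∀ t : ℕ, Real.exp (-((1 + 1 / l) * d * (t / n : ℝ) ^ (k - 1))) ≤
      (1 - m / n.choose k : ℝ) ^ t.choose (k - 1))
    (hst : StageCondition k d l ω ω' r) :
    randomHypergraphProb n m k (fun E => HasSaturated E ⌊ω * n⌋₊ (⌊ω' * n⌋₊ + 1) r) ≤
      (n.choose k + 1) * Real.exp (-(ω * n)) := by
  have hn' : (0 : ℝ) < n := by exact_mod_cast hn
  have hr' : (0 : ℝ) < r := by exact_mod_cast hr
  set w := ⌊ω * n⌋₊ with hw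
  have hwle : (w : ℝ) ≤ ω * n := Nat.floor_le (by positivity)
  set y := Real.exp (-((1 + 1 / l) ^ k * d * (ω / r) ^ (k - 1))) with hy
  have h1 := randomHypergraphProb_hasSaturated_le (u := ⌊ω' * n⌋₊ + 1) (w := w) hm hk hk2 hr hl
    (y := y) (Real.exp_pos _).le (fun t ht => ?_)
  · refine h1.trans ?_
    have h2 := choose_le_exp hω hω1 hwle
    have h3 : ((r : ℝ) + 1) ^ w ≤ Real.exp (ω * n * Real.log (r + 1)) := by
      rw [← Real.exp_log (by positivity : (0 : ℝ) < r + 1), ← Real.exp_nat_mul, Real.exp_log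
        (by positivity)]
      gcongr
      exact Real.log_nonneg (by linarith)
    have h4 : ω' * n ≤ ((⌊ω' * n⌋₊ + 1 : ℕ) : ℝ) := by
      push_cast; exact (Nat.lt_floor_add_one _).le
    have h5 : ω * (2 + Real.log (1 / ω) + Real.log (r + 1)) * n ≤
        ((⌊ω' * n⌋₊ + 1 : ℕ) : ℝ) * (r / (l + 1) * y) := by
      calc _ ≤ ω' * (r / (l + 1) * y) * n :=
            mul_le_mul_of_nonneg_right hst hn'.le
        _ = ω' * n * (r / (l + 1) * y) := by ring
        _ ≤ _ := by gcongr
    calc _ ≤ Real.exp (ω * n * (1 + Real.log (1 / ω))) * Real.exp (ω * n * Real.log (r + 1)) *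
          ((n.choose k + 1) *
            Real.exp (-(ω * (2 + Real.log (1 / ω) + Real.log (r + 1)) * n))) := by gcongr
      _ = (n.choose k + 1) * (Real.exp (ω * n * (1 + Real.log (1 / ω))) *
            Real.exp (ω * n * Real.log (r + 1)) *
            Real.exp (-(ω * (2 + Real.log (1 / ω) + Real.log (r + 1)) * n))) := by ring
      _ = _ := by
        rw [← Real.exp_add, ← Real.exp_add]
        ring_nf
  · refine le_trans (Real.exp_le_exp.2 (neg_le_neg ?_)) (hmiss t)
    have h2 : (t / n : ℝ) ≤ (1 + 1 / l) * (ω / r) := by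
      rw [div_le_iff₀ hn']
      refine ht.trans ?_
      calc (1 + 1 / l) * w / r ≤ (1 + 1 / l) * (ω * n) / r := by gcongr
        _ = _ := by ring
    calc (1 + 1 / l) * d * (t / n : ℝ) ^ (k - 1)
        ≤ (1 + 1 / l) * d * ((1 + 1 / l) * (ω / r)) ^ (k - 1) := by gcongr
      _ = (1 + 1 / l) ^ (k - 1 + 1) * d * (ω / r) ^ (k - 1) := by rw [mul_pow]; ring
      _ = _ := by rw [Nat.sub_add_cancel (by omega)]

theorem sum_Icc_mul_half_pow_le (s : ℕ) :
    ∑ w ∈ Finset.Icc 1 s, (w : ℝ) * (1 / 2) ^ (w - 1) ≤ 4 := by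
  have h : ∀ s : ℕ, ∑ w ∈ Finset.Icc 1 s, (w : ℝ) * (1 / 2) ^ (w - 1) =
      4 - (s + 2) * 2 * (1 / 2) ^ s := by
    intro s
    induction s with
    | zero => norm_num
    | succ s ih =>
      rw [Finset.sum_Icc_succ_top (by omega), ih, Nat.add_sub_cancel]
      push_cast
      ring
  rw [h]
  have : (0 : ℝ) ≤ (s + 2) * 2 * (1 / 2) ^ s := by positivity
  linarith

/-- Sets of size `w` contribute at most `b ^ w`, where `b ≤ 1/2` because `κ` exceeds `log d + 4`,
and also `b = O(w / n)`. Using the second bound once and the first `w - 1` times makes the sum over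
`w` of order `1 / n`. -/
theorem randomHypergraphProb_hasDense_le_div {n k κ : ℕ} {d ω : ℝ} (hd : 1 ≤ d) (hk : k ≤ n)
    (hm : ⌊d * n / k⌋₊ ≤ n.choose k) (hk2 : 2 ≤ k) (hn : 0 < n) (hω : 0 ≤ ω) (hω1 : ω ≤ 1)
    (hκ : Real.log d + 4 ≤ κ) (hκω : Real.exp 2 * d * ω ^ (k - 1) ≤ κ) :
    randomHypergraphProb n ⌊d * n / k⌋₊ k (fun E => HasDense E ⌊ω * n⌋₊ κ) ≤
      4 * (Real.exp 3 * d ^ 2) / n := by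
  have hn' : (0 : ℝ) < n := by exact_mod_cast hn
  have hk' : (1 : ℝ) ≤ k := by exact_mod_cast (by omega : 1 ≤ k)
  have hκ4 : (4 : ℝ) ≤ κ := by linarith [Real.log_nonneg hd]
  have hκ0 : (0 : ℝ) < κ := by linarith
  have hκn : 4 ≤ κ := by exact_mod_cast hκ4
  have hNk : (0 : ℝ) < n.choose k := by exact_mod_cast Nat.choose_pos hk
  refine (randomHypergraphProb_hasDense_le hm hk).trans ?_
  have hterm : ∀ w ∈ Finset.Icc 1 ⌊ω * n⌋₊, (n.choose w : ℝ) * ((w.choose k).choose (κ * w) *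
      (⌊d * n / k⌋₊ / n.choose k : ℝ) ^ (κ * w)) ≤
      Real.exp 3 * d ^ 2 / n * (w * (1 / 2) ^ (w - 1)) := by
    intro w hw
    obtain ⟨hw1, hws⟩ := Finset.mem_Icc.1 hw
    have hw0 : (0 : ℝ) < w := by exact_mod_cast hw1
    have hwω : (w : ℝ) ≤ ω * n := (Nat.le_floor_iff (by positivity)).1 hws
    have hwn : w ≤ n := by
      have : (w : ℝ) ≤ n := by nlinarith
      exact_mod_cast this
    set x : ℝ := w / n with hx
    have hx0 : 0 < x := by positivity
    have hxω : x ≤ ω := by rw [hx, div_le_iff₀ hn']; exact hwω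
    have hx1 : x ≤ 1 := hxω.trans hω1
    -- `z` bounds the contribution per edge: the choice of an edge inside the set, at `e (w.choose
    -- k) / (κ w)`, times the edge density.
    set z : ℝ := Real.exp 1 * d * x ^ (k - 1) / κ with hz
    have hz0 : 0 ≤ z := by positivity
    have hze : z ≤ Real.exp (-1) := by
      rw [hz, div_le_iff₀ hκ0]
      have h1 : Real.exp 1 * d * x ^ (k - 1) ≤ Real.exp 1 * d * ω ^ (k - 1) := by gcongr
      have h2 : Real.exp 1 * d * ω ^ (k - 1) = Real.exp (-1) * (Real.exp 2 * d * ω ^ (k - 1)) := by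
        rw [← mul_assoc, ← mul_assoc, ← Real.exp_add]; norm_num
      rw [h2] at h1
      exact h1.trans (by gcongr)
    have hz1 : z ≤ 1 := hze.trans (Real.exp_le_one_iff.2 (by norm_num))
    have hzx : z ≤ Real.exp 1 * d * x := by
      have h1 : x ^ (k - 1) ≤ x := by
        calc x ^ (k - 1) ≤ x ^ 1 := pow_le_pow_of_le_one hx0.le hx1 (by omega)
          _ = x := pow_one x
      calc z ≤ Real.exp 1 * d * x ^ (k - 1) := div_le_self (by positivity) (by linarith)
        _ ≤ _ := by gcongr
    have hp : (⌊d * n / k⌋₊ : ℝ) ≤ d * n := by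
      refine (Nat.floor_le (by positivity)).trans (div_le_self (by positivity) hk')
    -- the second factor is at most `z ^ (κ * w)`
    have h2 : ((w.choose k).choose (κ * w) : ℝ) * (⌊d * n / k⌋₊ / n.choose k : ℝ) ^ (κ * w) ≤
        z ^ (κ * w) := by
      have h3 := choose_le_exp_mul_div_pow (a := w.choose k) (b := κ * w)
        (by positivity)
      refine (mul_le_mul_of_nonneg_right h3 (by positivity)).trans ?_
      rw [← mul_pow]
      refine pow_le_pow_left₀ (by positivity) ?_ _
      calc Real.exp 1 * (w.choose k : ℕ) / ((κ * w : ℕ) : ℝ) * (⌊d * n / k⌋₊ / n.choose k : ℝ)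
          = Real.exp 1 / (κ * w) * (⌊d * n / k⌋₊ * ((w.choose k : ℝ) / n.choose k)) := by
            push_cast; field_simp
        _ ≤ Real.exp 1 / (κ * w) * (d * n * (w / n : ℝ) ^ k) := by
            gcongr
            exact choose_div_choose_le hwn hk
        _ = _ := by
            rw [hz, ← hx, ← Nat.sub_add_cancel (by omega : 1 ≤ k), pow_succ, Nat.add_sub_cancel]
            nth_rewrite 2 [hx]
            field_simp
    have h1 : (n.choose w : ℝ) ≤ (Real.exp 1 / x) ^ w := by
      refine (choose_le_exp_mul_div_pow hw1).trans (le_of_eq ?_)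
      rw [hx]
      congr 1
      field_simp
    set b : ℝ := Real.exp 1 / x * z ^ κ with hb
    have hb0 : 0 ≤ b := by positivity
    have hbz : b ≤ Real.exp 2 * d * z ^ (κ - 1) := by
      have h5 : Real.exp 1 / x * z ≤ Real.exp 2 * d := by
        calc Real.exp 1 / x * z ≤ Real.exp 1 / x * (Real.exp 1 * d * x) := by gcongr
          _ = Real.exp 1 * Real.exp 1 * d := by field_simp
          _ = _ := by rw [← Real.exp_add]; norm_num
      calc b = Real.exp 1 / x * z * z ^ (κ - 1) := by
            rw [hb, mul_assoc, ← pow_succ', Nat.sub_add_cancel (by omega)]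
        _ ≤ _ := by gcongr
    have hbA : b ≤ Real.exp 3 * d ^ 2 * x := by
      calc b ≤ Real.exp 2 * d * z ^ (κ - 1) := hbz
        _ ≤ Real.exp 2 * d * z ^ 1 := by
            gcongr ?_ * ?_
            exact pow_le_pow_of_le_one hz0 hz1 (by omega)
        _ ≤ Real.exp 2 * d * (Real.exp 1 * d * x) := by rw [pow_one]; gcongr
        _ = Real.exp 2 * Real.exp 1 * d ^ 2 * x := by ring
        _ = _ := by rw [← Real.exp_add]; norm_num
    have hbh : b ≤ 1 / 2 := by
      calc b ≤ Real.exp 2 * d * z ^ (κ - 1) := hbz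
        _ ≤ Real.exp 2 * d * Real.exp (-1) ^ (κ - 1) := by gcongr
        _ = Real.exp (2 + Real.log d - (κ - 1)) := by
            rw [← Real.exp_nat_mul, sub_eq_add_neg, Real.exp_add, Real.exp_add,
              Real.exp_log (by linarith), Nat.cast_sub (by omega)]
            push_cast
            ring_nf
        _ ≤ Real.exp (-1) := Real.exp_le_exp.2 (by linarith)
        _ ≤ 1 / 2 := by
            rw [Real.exp_neg, one_div]
            refine inv_anti₀ two_pos ?_
            have := Real.add_one_le_exp (1 : ℝ)
            linarith
    calc _ ≤ (Real.exp 1 / x) ^ w * z ^ (κ * w) := by gcongr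
      _ = b ^ w := by rw [hb, mul_pow, ← pow_mul]
      _ = b * b ^ (w - 1) := by rw [← pow_succ', Nat.sub_add_cancel hw1]
      _ ≤ (Real.exp 3 * d ^ 2 * x) * (1 / 2) ^ (w - 1) := by gcongr
      _ = _ := by rw [hx]; ring
  refine (Finset.sum_le_sum hterm).trans ?_
  rw [← Finset.mul_sum]
  calc _ ≤ Real.exp 3 * d ^ 2 / n * 4 := by gcongr; exact sum_Icc_mul_half_pow_le _
    _ = _ := by ring

/-- The parameters of a three-stage greedy procedure for which all bad events are unlikely. -/
structure AdmissibleParams (k : ℕ) (d : ℝ) (r₀ r₁ r₂ κ : ℕ) (ω₁ ω₂ ω₃ : ℝ) : Prop where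
  r₀_pos : 0 < r₀
  r₁_pos : 0 < r₁
  r₂_pos : 0 < r₂
  ω₁_ge : 1 / d ≤ ω₁
  ω₁_le : ω₁ ≤ 1
  ω₂_ge : 1 / d ≤ ω₂
  ω₂_le : ω₂ ≤ 1
  ω₃_nonneg : 0 ≤ ω₃
  ω₃_le : ω₃ ≤ 1
  stage₀ : StageCondition k d (Real.log d) 1 ω₁ r₀
  stage₁ : StageCondition k d (Real.log d) ω₁ ω₂ r₁
  stage₂ : StageCondition k d (Real.log d) ω₂ ω₃ r₂
  log_le : Real.log d + 4 ≤ κ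
  dense : Real.exp 2 * d * ω₃ ^ (k - 1) ≤ κ

/-- The bad events are the failures of the three windows and the existence of a dense small set. All
fractions `ω` are at least `1 / d ≥ 1 / D`, so the bound depends on `n`, `k` and `D` only. -/
theorem randomHypergraphProb_not_greedyDegenerate_le {n k r₀ r₁ r₂ κ : ℕ} {d D ω₁ ω₂ ω₃ : ℝ}
    (hk2 : 2 ≤ k) (hk : k ≤ n) (hn : 0 < n) (hd : 1 < d) (hdD : d ≤ D)
    (hm : ⌊d * n / k⌋₊ ≤ n.choose k)
    (hmiss : ∀ t : ℕ, Real.exp (-((1 + 1 / Real.log D) * d * (t / n : ℝ) ^ (k - 1))) ≤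
      (1 - ⌊d * n / k⌋₊ / n.choose k : ℝ) ^ t.choose (k - 1))
    (h : AdmissibleParams k d r₀ r₁ r₂ κ ω₁ ω₂ ω₃) :
    randomHypergraphProb n ⌊d * n / k⌋₊ k (fun E => ¬ GreedyDegenerate E (r₀ + r₁ + r₂) (k * κ)) ≤
      3 * (((n : ℝ) ^ k + 1) * Real.exp (-(1 / D * n))) + 4 * (Real.exp 3 * D ^ 2) / n := by
  have hn' : (0 : ℝ) < n := by exact_mod_cast hn
  have hl : 0 < Real.log d := Real.log_pos hd
  have hd0 : 0 < d := by linarith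
  have hD0 : 0 < D := by linarith
  have hmiss' : ∀ t : ℕ, Real.exp (-((1 + 1 / Real.log d) * d * (t / n : ℝ) ^ (k - 1))) ≤
      (1 - ⌊d * n / k⌋₊ / n.choose k : ℝ) ^ t.choose (k - 1) := by
    intro t
    refine le_trans (Real.exp_le_exp.2 (neg_le_neg ?_)) (hmiss t)
    gcongr
  have hdinv : 1 / D ≤ 1 / d := one_div_le_one_div_of_le hd0 hdD
  have hdpos : 0 < 1 / d := by positivity
  have hd1 : 1 / d ≤ 1 := by rw [div_le_one hd0]; exact hd.le
  have hchoose : (n.choose k : ℝ) ≤ (n : ℝ) ^ k := by exact_mod_cast Nat.choose_le_pow n k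
  have hstage : ∀ {r : ℕ} {ω ω' : ℝ}, 0 < r → 1 / d ≤ ω → ω ≤ 1 →
      StageCondition k d (Real.log d) ω ω' r →
      randomHypergraphProb n ⌊d * n / k⌋₊ k
        (fun E => HasSaturated E ⌊ω * n⌋₊ (⌊ω' * n⌋₊ + 1) r) ≤
      ((n : ℝ) ^ k + 1) * Real.exp (-(1 / D * n)) := by
    intro r ω ω' hr hω hω1 hst
    refine (randomHypergraphProb_hasSaturated_le_exp hm hk hk2 hr hn hd0.le hl (by linarith) hω1
      hmiss' hst).trans ?_
    gcongr
    linarith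
  have s₀ := hstage h.r₀_pos hd1 le_rfl h.stage₀
  have s₁ := hstage h.r₁_pos h.ω₁_ge h.ω₁_le h.stage₁
  have s₂ := hstage h.r₂_pos h.ω₂_ge h.ω₂_le h.stage₂
  have s₃ := randomHypergraphProb_hasDense_le_div hd.le hk hm hk2 hn h.ω₃_nonneg h.ω₃_le h.log_le
    h.dense
  have s₃' : 4 * (Real.exp 3 * d ^ 2) / (n : ℝ) ≤ 4 * (Real.exp 3 * D ^ 2) / n := by gcongr
  have hfloor : ∀ {ω : ℝ}, ω ≤ 1 → ⌊ω * n⌋₊ ≤ n := by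
    intro ω hω
    refine Nat.floor_le_of_le ?_
    nlinarith
  rw [one_mul, Nat.floor_natCast] at s₀
  have hsub := randomHypergraphProb_mono (n := n) (m := ⌊d * n / k⌋₊) (k := k)
    (P := fun E => ¬ GreedyDegenerate E (r₀ + r₁ + r₂) (k * κ))
    (Q := fun E => ((HasSaturated E n (⌊ω₁ * n⌋₊ + 1) r₀ ∨
      HasSaturated E ⌊ω₁ * n⌋₊ (⌊ω₂ * n⌋₊ + 1) r₁) ∨
      HasSaturated E ⌊ω₂ * n⌋₊ (⌊ω₃ * n⌋₊ + 1) r₂) ∨ HasDense E ⌊ω₃ * n⌋₊ κ) (by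
    intro E hE hnot
    by_contra! hcon
    obtain ⟨⟨⟨c₀, c₁⟩, c₂⟩, c₃⟩ := hcon
    exact hnot (greedyDegenerate_of_stages (card_of_mem_uniformHypergraphs hE) h.r₀_pos h.r₁_pos
      h.r₂_pos (by simpa using hfloor h.ω₁_le) (by simpa using hfloor h.ω₂_le)
      (by simpa using c₀) c₁ c₂ c₃))
  refine hsub.trans ?_
  have u₁ := randomHypergraphProb_or_le (n := n) (m := ⌊d * n / k⌋₊) (k := k)
    (fun E => (HasSaturated E n (⌊ω₁ * n⌋₊ + 1) r₀ ∨
      HasSaturated E ⌊ω₁ * n⌋₊ (⌊ω₂ * n⌋₊ + 1) r₁) ∨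
      HasSaturated E ⌊ω₂ * n⌋₊ (⌊ω₃ * n⌋₊ + 1) r₂) (fun E => HasDense E ⌊ω₃ * n⌋₊ κ)
  have u₂ := randomHypergraphProb_or_le (n := n) (m := ⌊d * n / k⌋₊) (k := k)
    (fun E => HasSaturated E n (⌊ω₁ * n⌋₊ + 1) r₀ ∨
      HasSaturated E ⌊ω₁ * n⌋₊ (⌊ω₂ * n⌋₊ + 1) r₁)
    (fun E => HasSaturated E ⌊ω₂ * n⌋₊ (⌊ω₃ * n⌋₊ + 1) r₂)
  have u₃ := randomHypergraphProb_or_le (n := n) (m := ⌊d * n / k⌋₊) (k := k)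
    (fun E => HasSaturated E n (⌊ω₁ * n⌋₊ + 1) r₀)
    (fun E => HasSaturated E ⌊ω₁ * n⌋₊ (⌊ω₂ * n⌋₊ + 1) r₁)
  linarith

theorem tendsto_error (k : ℕ) {D : ℝ} (hD : 0 < D) :
    Tendsto (fun n : ℕ => 3 * (((n : ℝ) ^ k + 1) * Real.exp (-(1 / D * n))) +
      4 * (Real.exp 3 * D ^ 2) / n) atTop (𝓝 0) := by
  have hx : Tendsto (fun n : ℕ => 1 / D * (n : ℝ)) atTop atTop :=
    tendsto_natCast_atTop_atTop.const_mul_atTop (by positivity)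
  have h1 := (Real.tendsto_pow_mul_exp_neg_atTop_nhds_zero k).comp hx
  have h2 := (Real.tendsto_pow_mul_exp_neg_atTop_nhds_zero 0).comp hx
  have h3 : Tendsto (fun n : ℕ => 4 * (Real.exp 3 * D ^ 2) / (n : ℝ)) atTop (𝓝 0) :=
    tendsto_const_div_atTop_nhds_zero_nat _
  have h4 := (((h1.const_mul (D ^ k)).add h2).const_mul 3).add h3
  simp only [mul_zero, add_zero] at h4
  refine h4.congr fun n => ?_
  simp only [Function.comp_apply, pow_zero, one_mul]
  have : D ^ k * ((1 / D * (n : ℝ)) ^ k * Real.exp (-(1 / D * n))) =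
      (n : ℝ) ^ k * Real.exp (-(1 / D * n)) := by
    rw [mul_pow, div_pow, one_pow]
    field_simp
  rw [this]
  ring

end Estimates

/-! ### Choice of parameters for large degree, and the limit -/

section Parameters

theorem one_add_pow_le {x : ℝ} (hx0 : 0 ≤ x) (hx1 : x ≤ 1) (k : ℕ) :
    (1 + x) ^ k ≤ 1 + 2 ^ k * x := by
  have h : (1 + x) ^ k ≤ 1 + (2 ^ k - 1) * x := by
    induction k with
    | zero => simp
    | succ k ih =>
      have h2 : (0 : ℝ) ≤ 2 ^ k - 1 := sub_nonneg.2 (one_le_pow₀ one_le_two)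
      have h3 : (2 ^ k - 1) * (x * x) ≤ (2 ^ k - 1) * x := by
        gcongr
        nlinarith
      calc (1 + x) ^ (k + 1) = (1 + x) ^ k * (1 + x) := pow_succ _ _
        _ ≤ (1 + (2 ^ k - 1) * x) * (1 + x) := by gcongr
        _ ≤ _ := by rw [pow_succ]; nlinarith
  linarith

theorem rpow_le_one_add {x a : ℝ} (hx : 0 ≤ x) (ha0 : 0 ≤ a) (ha : a ≤ 1) : x ^ a ≤ 1 + x := by
  rcases le_total x 1 with h | h
  · exact (Real.rpow_le_one hx h ha0).trans (by linarith)
  · calc x ^ a ≤ x ^ (1 : ℝ) := Real.rpow_le_rpow_of_exponent_le h ha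
      _ ≤ _ := by rw [Real.rpow_one]; linarith

theorem StageCondition.of_exponent_le {k r : ℕ} {d l ω ω' Y : ℝ} (hl : 0 < l) (hω' : 0 ≤ ω')
    (hY : (1 + 1 / l) ^ k * d * (ω / r) ^ (k - 1) ≤ Y)
    (h : ω * (2 + Real.log (1 / ω) + Real.log (r + 1)) ≤
      ω' * (r / (l + 1) * Real.exp (-Y))) : StageCondition k d l ω ω' r := by
  refine h.trans ?_
  gcongr

set_option maxHeartbeats 4000000 in
/-- Explicit largeness conditions on `l = log d` give admissible parameters. -/
theorem exists_admissibleParams_of_large {k : ℕ} (hk : 2 ≤ k) {d : ℝ} (hd : 10 ≤ d)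
    (c1 : 4 ≤ Real.log d)
    (c2 : 6 * Real.exp (2 ^ k) ≤ Real.log d ^ (1 / 2 : ℝ))
    (c3 : (2 + 2 * Real.log d) * Real.log d ^ 2 * (Real.log d + 1) * Real.exp (2 ^ k) ≤
      Real.exp (Real.log d / (3 * (k - 1 : ℕ))))
    (c4 : 5 * (k - 1 : ℕ) * Real.log (Real.log d) + 2 * (k - 1 : ℕ) ≤ Real.log d)
    (c5 : 2 ^ (k - 1) * 4 ≤ (k - 1 : ℕ) / 2 * Real.log (Real.log d))
    (c6 : 3 * k * (Real.exp 2 * ((2 * Real.exp (2 ^ k)) ^ (k - 1) *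
      ((Real.log d + 1) ^ 2) ^ (k - 1)) + Real.log d + 5) + 4 ≤ 3 * Real.log d ^ (3 * k)) :
    ∃ (r₀ r₁ r₂ κ : ℕ) (ω₁ ω₂ ω₃ : ℝ), AdmissibleParams k d r₀ r₁ r₂ κ ω₁ ω₂ ω₃ ∧
      ((r₀ + r₁ + r₂ + 3 * (k * κ) + 2 : ℕ) : ℝ) ≤ alphaParam k d + betaParam k d + 1 ∧
      ((r₀ + r₁ + r₂ : ℕ) : ℝ) ≤ d := by
  obtain ⟨K, rfl⟩ : ∃ K, k = K + 1 := ⟨k - 1, by omega⟩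
  rw [Nat.add_sub_cancel] at c3 c4 c5 c6
  have hK1 : 1 ≤ K := by omega
  have hK : (1 : ℝ) ≤ K := by exact_mod_cast hK1
  have hK0 : K ≠ 0 := by omega
  have hKpos : (0 : ℝ) < K := by linarith
  set l := Real.log d with hl
  have hl0 : 0 < l := by linarith
  have hd0 : 0 < d := by linarith
  have hexpl : Real.exp l = d := Real.exp_log hd0
  set M := Real.exp (2 ^ (K + 1)) with hM
  have hM1 : 1 ≤ M := Real.one_le_exp (by positivity)
  -- `δ = d^(1/K)` is the order of `α` up to a power of `l`; its cube root `ε` is the scale of the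
  -- intermediate stage.
  set δ := Real.exp (l / K) with hδ
  have hδ0 : 0 < δ := Real.exp_pos _
  have hδK : δ ^ K = d := by
    rw [hδ, ← Real.exp_nat_mul, mul_div_cancel₀ _ hKpos.ne', hexpl]
  set ε := Real.exp (l / (3 * K)) with hε
  have hε0 : 0 < ε := Real.exp_pos _
  have hε3 : ε ^ 3 = δ := by
    rw [hε, hδ, ← Real.exp_nat_mul]; congr 1; push_cast; field_simp
  have hll : 0 ≤ Real.log l := Real.log_nonneg (by linarith)
  have hlogl : Real.log l ≤ l := Real.log_le_self hl0.le
  have hεl : l ^ 2 ≤ ε := by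
    refine le_trans ?_ c3
    have h1 : 1 ≤ (2 + 2 * l) * (l + 1) * M :=
      one_le_mul_of_one_le_of_one_le (one_le_mul_of_one_le_of_one_le (by linarith only [hl0])
        (by linarith only [hl0])) hM1
    calc l ^ 2 = l ^ 2 * 1 := (mul_one _).symm
      _ ≤ l ^ 2 * ((2 + 2 * l) * (l + 1) * M) := by gcongr
      _ = _ := by ring
  have hε1 : 1 ≤ ε := (one_le_pow₀ (by linarith only [c1])).trans hεl
  -- the two denominators
  set A := l - 5 * K * Real.log l with hA
  set B := l - 9 / 2 * K * Real.log l with hB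
  have hA0 : 2 * K ≤ A := by rw [hA]; linarith
  have hApos : 0 < A := by linarith
  have hAB : A + 2 ^ K * 4 ≤ B := by rw [hA, hB]; linarith only [c5]
  have hBpos : 0 < B := by
    have : (0 : ℝ) ≤ 2 ^ K * 4 := by positivity
    linarith
  have hBl : B ≤ l := by
    rw [hB]
    have : 0 ≤ 9 / 2 * (K : ℝ) * Real.log l := by positivity
    linarith
  have hAl : A ≤ l := by
    have : (0 : ℝ) ≤ 2 ^ K * 4 := by positivity
    linarith
  set α := alphaParam (K + 1) d with hα
  have hα' : α = (K * d / A) ^ ((K : ℝ)⁻¹) := by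
    rw [hα, alphaParam, hA, ← hl]
    push_cast
    rw [add_sub_cancel_right, one_div]
  have hα0 : 0 ≤ α := by rw [hα']; positivity
  have hαK : α ^ K = K * d / A := by rw [hα']; exact Real.rpow_inv_natCast_pow (by positivity) hK0
  -- This gives `d / ρ^K = B / K = l / K - (9/2) log l`, so a class of average size in the first
  -- window fails to block a vertex with probability of order at least `l^(9/2) / δ`.
  set ρ := (K * d / B) ^ ((K : ℝ)⁻¹) with hρ
  have hρ0 : 0 < ρ := by rw [hρ]; positivity
  have hρK : ρ ^ K = K * d / B := by rw [hρ]; exact Real.rpow_inv_natCast_pow (by positivity) hK0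
  have hρδ : δ / l ≤ ρ := by
    refine le_of_pow_le_pow_left₀ hK0 hρ0.le ?_
    rw [hρK, div_pow, hδK]
    have h1 : l ≤ l ^ K := le_self_pow₀ (by linarith) hK0
    calc d / l ^ K ≤ d / l := by gcongr
      _ ≤ d / B := by gcongr
      _ ≤ K * d / B := by gcongr; exact le_mul_of_one_le_left hd0.le hK
  -- The passage from `5` to `9/2` in the denominator gains `(K/2) log l`, enough for a factor `1 +
  -- 4/l`: the share `3/l` pays for the second window and `1/l` for the third, up to rounding.
  have hρα : ρ * (1 + 4 / l) ≤ α := by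
    refine le_of_pow_le_pow_left₀ hK0 hα0 ?_
    rw [mul_pow, hρK, hαK]
    have h1 : (1 + 4 / l) ^ K ≤ 1 + 2 ^ K * (4 / l) :=
      one_add_pow_le (by positivity) ((div_le_one hl0).2 c1) K
    have h2 : A * (1 + 2 ^ K * (4 / l)) ≤ B := by
      have h3 : A * (2 ^ K * (4 / l)) ≤ l * (2 ^ K * (4 / l)) := by gcongr
      have h4 : l * (2 ^ K * (4 / l)) = 2 ^ K * 4 := by field_simp
      linarith
    calc K * d / B * (1 + 4 / l) ^ K ≤ K * d / B * (1 + 2 ^ K * (4 / l)) := by gcongr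
      _ = K * d / (A * B) * (A * (1 + 2 ^ K * (4 / l))) := by field_simp
      _ ≤ K * d / (A * B) * B := by gcongr
      _ = _ := by field_simp
  have hαd : α ≤ 1 + d / 2 := by
    rw [hα']
    refine (rpow_le_one_add (by positivity) (by positivity) (inv_le_one_of_one_le₀ hK)).trans ?_
    have : K * d / A ≤ d / 2 := by
      rw [div_le_div_iff₀ hApos two_pos]
      linarith only [mul_le_mul_of_nonneg_left hA0 hd0.le]
    linarith
  -- the numbers of colors
  set r₀ := ⌈ρ⌉₊ with hr₀
  -- The factor `3` divides the exponent of the second window by at least `3`, making the miss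
  -- probability at least of order `1 / ε`. In the third window `ε ^ 2` classes on `n / ε` vertices
  -- have average size at most `n / δ`, and the exponent is bounded.
  set r₁ := ⌈3 * ρ / l⌉₊ with hr₁
  set r₂ := ⌈ε ^ 2⌉₊ with hr₂
  have hr₀l : ρ ≤ r₀ := Nat.le_ceil _
  have hr₁l : 3 * ρ / l ≤ r₁ := Nat.le_ceil _
  have hr₂l : ε ^ 2 ≤ r₂ := Nat.le_ceil _
  have hr₀p : 0 < r₀ := Nat.ceil_pos.2 hρ0
  have hr₁p : 0 < r₁ := Nat.ceil_pos.2 (by positivity)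
  have hr₂p : 0 < r₂ := Nat.ceil_pos.2 (by positivity)
  have hr₀p' : (0 : ℝ) < r₀ := by exact_mod_cast hr₀p
  have hr₁p' : (0 : ℝ) < r₁ := by exact_mod_cast hr₁p
  have hr₂p' : (0 : ℝ) < r₂ := by exact_mod_cast hr₂p
  have hr₀u : (r₀ : ℝ) < ρ + 1 := Nat.ceil_lt_add_one hρ0.le
  have hr₁u : (r₁ : ℝ) < 3 * ρ / l + 1 := Nat.ceil_lt_add_one (by positivity)
  have hr₂u : (r₂ : ℝ) < ε ^ 2 + 1 := Nat.ceil_lt_add_one (by positivity)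
  have hε2ρ : ε ^ 2 ≤ ρ / l := by
    calc ε ^ 2 = ε ^ 2 * l ^ 2 / l ^ 2 := by field_simp
      _ ≤ ε ^ 2 * ε / l ^ 2 := by gcongr
      _ = δ / l / l := by rw [← hε3]; field_simp
      _ ≤ _ := by gcongr
  have hsum : (r₀ : ℝ) + r₁ + r₂ ≤ α + 3 := by
    have : ρ * (1 + 4 / l) = ρ + 3 * ρ / l + ρ / l := by ring
    linarith
  have hsumd : (r₀ : ℝ) + r₁ + r₂ + 1 ≤ d := by linarith
  have hlog : ∀ r : ℕ, (r : ℝ) + 1 ≤ d → Real.log (r + 1) ≤ l := fun r hr =>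
    Real.log_le_log (by positivity) hr
  -- exponents
  have hpow : (1 + 1 / l) ^ (K + 1) ≤ 1 + 2 ^ (K + 1) * (1 / l) :=
    one_add_pow_le (by positivity) ((div_le_one hl0).2 (by linarith)) _
  have hpow2 : (1 + 1 / l) ^ (K + 1) ≤ 2 ^ (K + 1) := by
    gcongr
    have : 1 / l ≤ 1 := (div_le_one hl0).2 (by linarith)
    linarith
  have hexpM : Real.exp (-(2 ^ (K + 1))) = 1 / M := by rw [Real.exp_neg, one_div]
  -- the densest sets
  set ω₃ := 2 * M * (l + 1) ^ 2 / δ with hω₃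
  set X := Real.exp 2 * ((2 * M) ^ K * ((l + 1) ^ 2) ^ K) with hX
  have hX0 : 0 ≤ X := by positivity
  -- `X` equals `exp 2 * d * ω₃ ^ K`, the powers of `δ` cancelling against `d`; it is polynomial in
  -- `l`. So `κ` meets both the `log_le` and the `dense` requirements.
  set κ := ⌈X + l + 4⌉₊ with hκ
  have hκl : X + l + 4 ≤ κ := Nat.le_ceil _
  have hκu : (κ : ℝ) < X + l + 4 + 1 := Nat.ceil_lt_add_one (by positivity)
  have hεd : ε ≤ d := by
    rw [hε, ← hexpl]
    refine Real.exp_le_exp.2 (div_le_self hl0.le (by linarith))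
  refine ⟨r₀, r₁, r₂, κ, 1 / l, 1 / ε, ω₃, ?_, ?_, ?_⟩
  · refine
    { r₀_pos := hr₀p
      r₁_pos := hr₁p
      r₂_pos := hr₂p
      ω₁_ge := one_div_le_one_div_of_le hl0 (Real.log_le_self hd0.le)
      ω₁_le := (div_le_one hl0).2 (by linarith)
      ω₂_ge := one_div_le_one_div_of_le hε0 hεd
      ω₂_le := (div_le_one hε0).2 hε1
      ω₃_nonneg := by positivity
      ω₃_le := ?_
      stage₀ := ?_
      stage₁ := ?_
      stage₂ := ?_
      log_le := by linarith
      dense := ?_ }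
    · rw [hω₃, div_le_one hδ0, ← hε3]
      have h1 : 1 ≤ l ^ 2 := one_le_pow₀ (by linarith only [c1])
      have h2 : ε ≤ ε ^ 3 := le_self_pow₀ hε1 (by norm_num)
      calc 2 * M * (l + 1) ^ 2 = 2 * M * (l + 1) ^ 2 * 1 := (mul_one _).symm
        _ ≤ 2 * M * (l + 1) ^ 2 * l ^ 2 := by gcongr
        _ = (2 + 2 * l) * l ^ 2 * (l + 1) * M := by ring
        _ ≤ ε ^ 3 := c3.trans h2
    · -- first stage
      refine StageCondition.of_exponent_le (Y := l / K - 9 / 2 * Real.log l + 2 ^ (K + 1)) hl0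
        (by positivity) ?_ ?_
      · rw [Nat.add_sub_cancel]
        have h1 : d * (1 / r₀ : ℝ) ^ K ≤ B / K := by
          calc d * (1 / r₀ : ℝ) ^ K ≤ d * (1 / ρ) ^ K := by gcongr
            _ = B / K := by rw [div_pow, hρK]; field_simp; simp
        have h2 : B / K ≤ l := (div_le_self hBpos.le hK).trans hBl
        have h3 : B / K = l / K - 9 / 2 * Real.log l := by rw [hB]; field_simp
        calc (1 + 1 / l) ^ (K + 1) * d * (1 / r₀ : ℝ) ^ K
            ≤ (1 + 2 ^ (K + 1) * (1 / l)) * (B / K) := by rw [mul_assoc]; gcongr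
          _ = B / K + 2 ^ (K + 1) * ((B / K) / l) := by ring
          _ ≤ B / K + 2 ^ (K + 1) * 1 := by
              gcongr
              exact (div_le_one hl0).2 h2
          _ = _ := by rw [h3]; ring
      · have h1 : Real.exp (-(l / K - 9 / 2 * Real.log l + 2 ^ (K + 1))) =
            l ^ 4 * l ^ (1 / 2 : ℝ) / (δ * M) := by
          have h2 : l ^ 4 * l ^ (1 / 2 : ℝ) = Real.exp (9 / 2 * Real.log l) := by
            rw [← Real.rpow_natCast, ← Real.rpow_add hl0, Real.rpow_def_of_pos hl0]
            congr 1
            push_cast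
            ring
          rw [h2, hδ, hM, ← Real.exp_add, ← Real.exp_sub]
          ring_nf
        rw [h1]
        have h3 := hlog r₀ (by linarith)
        -- Of `l ^ (9/2)`, the half power covers `6 * M` by `c2`; the power `l ^ 4` leaves `6 l² /
        -- (l + 1)`, which dominates `2 + l`.
        calc 1 * (2 + Real.log (1 / 1) + Real.log (r₀ + 1)) ≤ 2 + l := by
              rw [div_one, Real.log_one]; linarith
          _ ≤ 1 / l * (δ / l / (l + 1) * (l ^ 4 * (6 * M) / (δ * M))) := by
              have h5 : 1 / l * (δ / l / (l + 1) * (l ^ 4 * (6 * M) / (δ * M))) =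
                  6 * l ^ 2 / (l + 1) := by field_simp
              rw [h5, le_div_iff₀ (by linarith)]
              nlinarith only [c1]
          _ ≤ _ := by
              have h4 : δ / l ≤ r₀ := hρδ.trans hr₀l
              gcongr
    · -- second stage
      refine StageCondition.of_exponent_le (Y := l / (3 * K) + 2 ^ (K + 1)) hl0
        (by positivity) ?_ ?_
      · rw [Nat.add_sub_cancel]
        have h1 : d * (1 / l / r₁ : ℝ) ^ K ≤ l / (3 * K) := by
          have h2 : (1 / l / r₁ : ℝ) ≤ 1 / (3 * ρ) := by
            rw [div_div]
            refine one_div_le_one_div_of_le (by positivity) ?_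
            rw [div_le_iff₀ hl0] at hr₁l
            linarith
          have h3 : (3 : ℝ) ≤ 3 ^ K := le_self_pow₀ (by norm_num) hK0
          calc d * (1 / l / r₁ : ℝ) ^ K ≤ d * (1 / (3 * ρ)) ^ K := by gcongr
            _ = B / (3 ^ K * K) := by rw [div_pow, mul_pow, hρK]; field_simp; simp
            _ ≤ l / (3 * K) := by gcongr
        calc (1 + 1 / l) ^ (K + 1) * d * (1 / l / r₁ : ℝ) ^ K
            ≤ (1 + 2 ^ (K + 1) * (1 / l)) * (l / (3 * K)) := by rw [mul_assoc]; gcongr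
          _ = l / (3 * K) + 2 ^ (K + 1) * (1 / (3 * K)) := by field_simp
          _ ≤ l / (3 * K) + 2 ^ (K + 1) * 1 := by
              gcongr
              rw [div_le_one (by positivity)]
              linarith
          _ = _ := by ring
      · have h1 : Real.exp (-(l / (3 * K) + 2 ^ (K + 1))) = 1 / (ε * M) := by
          rw [hε, hM, ← Real.exp_add, Real.exp_neg, one_div]
        rw [h1]
        have h3 := hlog r₁ (by linarith)
        have h4 : δ / l ^ 2 ≤ r₁ := by
          refine le_trans ?_ hr₁l
          calc δ / l ^ 2 = δ / l / l := by field_simp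
            _ ≤ ρ / l := by gcongr
            _ ≤ 3 * ρ / l := by gcongr; linarith
        have h5 : 1 / l ≤ 1 := (div_le_one hl0).2 (by linarith)
        calc 1 / l * (2 + Real.log (1 / (1 / l)) + Real.log (r₁ + 1))
            ≤ 1 * (2 + l + l) := by
              rw [one_div_one_div]
              have : 0 ≤ Real.log ((r₁ : ℝ) + 1) := Real.log_nonneg (by linarith)
              gcongr
          _ ≤ 1 / ε * (δ / l ^ 2 / (l + 1) * (1 / (ε * M))) := by
              have h6 : 1 / ε * (δ / l ^ 2 / (l + 1) * (1 / (ε * M))) =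
                  ε / (l ^ 2 * (l + 1) * M) := by
                rw [← hε3]; field_simp
              rw [h6, le_div_iff₀ (by positivity)]
              refine le_trans (le_of_eq ?_) c3
              ring
          _ ≤ _ := by gcongr
    · -- third stage
      refine StageCondition.of_exponent_le (Y := 2 ^ (K + 1)) hl0 (by positivity) ?_ ?_
      · rw [Nat.add_sub_cancel]
        have h1 : d * (1 / ε / r₂ : ℝ) ^ K ≤ 1 := by
          have h2 : (1 / ε / r₂ : ℝ) ≤ 1 / δ := by
            rw [div_div, ← hε3]
            refine one_div_le_one_div_of_le (by positivity) ?_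
            calc ε ^ 3 = ε * ε ^ 2 := by ring
              _ ≤ _ := by gcongr
          calc d * (1 / ε / r₂ : ℝ) ^ K ≤ d * (1 / δ) ^ K := by gcongr
            _ = 1 := by rw [div_pow, hδK]; field_simp; simp
        calc (1 + 1 / l) ^ (K + 1) * d * (1 / ε / r₂ : ℝ) ^ K ≤ 2 ^ (K + 1) * 1 := by
              rw [mul_assoc]; gcongr
          _ = _ := mul_one _
      · rw [hexpM]
        have h3 := hlog r₂ (by linarith)
        have h4 : Real.log (1 / (1 / ε)) ≤ l := by
          rw [one_div_one_div]
          exact Real.log_le_log hε0 hεd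
        calc 1 / ε * (2 + Real.log (1 / (1 / ε)) + Real.log (r₂ + 1))
            ≤ 1 / ε * (2 + l + l) := by gcongr
          _ = ω₃ * (ε ^ 2 / (l + 1) * (1 / M)) := by
              rw [hω₃, ← hε3]; field_simp; ring
          _ ≤ _ := by gcongr
    · rw [Nat.add_sub_cancel]
      have h1 : Real.exp 2 * d * ω₃ ^ K = X := by
        rw [hω₃, hX, div_pow, mul_pow, hδK]; field_simp
      linarith
  · have h1 : 3 * ((K + 1 : ℕ) : ℝ) * κ ≤ 3 * ((K + 1 : ℕ) : ℝ) * (X + l + 5) := by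
      gcongr
      linarith
    have hβ : betaParam (K + 1) d = 3 * l ^ (3 * (K + 1)) := rfl
    rw [hβ]
    push_cast at h1 c6 ⊢
    linarith
  · push_cast
    linarith

theorem eventually_polynomial_le_exp (c a : ℝ) (hc : 0 < c) :
    ∀ᶠ l : ℝ in atTop, (2 + 2 * l) * l ^ 2 * (l + 1) * a ≤ Real.exp (l / c) := by
  have h1 : ∀ᶠ x : ℝ in atTop, 4 * c ^ 4 * 2 * |a| * x ^ 4 ≤ Real.exp x := by
    have h := (Real.tendsto_exp_div_pow_atTop 4).eventually_ge_atTop (4 * c ^ 4 * 2 * |a|)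
    filter_upwards [h, eventually_gt_atTop 0] with x hx hx0
    rwa [le_div_iff₀ (by positivity)] at hx
  have h2 := (tendsto_id.atTop_div_const hc).eventually h1
  filter_upwards [h2, eventually_ge_atTop 1] with l hl hl1
  refine le_trans ?_ hl
  have h3 : (2 + 2 * l) * l ^ 2 * (l + 1) ≤ 4 * l * l ^ 2 * (2 * l) := by
    gcongr <;> linarith
  calc (2 + 2 * l) * l ^ 2 * (l + 1) * a ≤ (2 + 2 * l) * l ^ 2 * (l + 1) * |a| := by
        gcongr
        exact le_abs_self a
    _ ≤ 4 * l * l ^ 2 * (2 * l) * |a| := by gcongr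
    _ = _ := by simp only [id]; field_simp

theorem eventually_polynomial_le_pow {k : ℕ} (hk : 2 ≤ k) (a b c : ℝ) (hb : 0 ≤ b) :
    ∀ᶠ l : ℝ in atTop, 3 * k * (a * (b * ((l + 1) ^ 2) ^ (k - 1)) + l + 5) + 4 ≤
      c * l ^ (3 * k) ∨ c ≤ 0 := by
  rcases le_or_gt c 0 with hc | hc
  · exact Eventually.of_forall fun _ => Or.inr hc
  have h : ∀ᶠ l : ℝ in atTop, (3 * k * (|a| * b * 4 ^ (k - 1) + 6) + 4) / c ≤ l :=
    eventually_ge_atTop _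
  filter_upwards [h, eventually_ge_atTop 1] with l hl hl1
  left
  rw [div_le_iff₀ hc] at hl
  have hp : ∀ j ≤ 3 * k - 1, l ^ j ≤ l ^ (3 * k - 1) := fun j hj => pow_le_pow_right₀ hl1 hj
  have h1 : ((l + 1) ^ 2) ^ (k - 1) ≤ 4 ^ (k - 1) * l ^ (3 * k - 1) := by
    calc ((l + 1) ^ 2) ^ (k - 1) ≤ ((2 * l) ^ 2) ^ (k - 1) := by gcongr; linarith
      _ = 4 ^ (k - 1) * l ^ (2 * (k - 1)) := by rw [mul_pow, mul_pow, ← pow_mul l]; norm_num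
      _ ≤ _ := by
          exact mul_le_mul_of_nonneg_left (hp (2 * (k - 1)) (by omega)) (by positivity)
  have h2 : l ≤ l ^ (3 * k - 1) := by simpa using hp 1 (by omega)
  have h3 : (1 : ℝ) ≤ l ^ (3 * k - 1) := one_le_pow₀ hl1
  have h4 : a * (b * ((l + 1) ^ 2) ^ (k - 1)) ≤ |a| * (b * (4 ^ (k - 1) * l ^ (3 * k - 1))) := by
    calc _ ≤ |a| * (b * ((l + 1) ^ 2) ^ (k - 1)) := by
          gcongr
          exact le_abs_self a
      _ ≤ _ := by gcongr
  calc 3 * k * (a * (b * ((l + 1) ^ 2) ^ (k - 1)) + l + 5) + 4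
      ≤ 3 * k * (|a| * (b * (4 ^ (k - 1) * l ^ (3 * k - 1))) + l ^ (3 * k - 1) +
          5 * l ^ (3 * k - 1)) + 4 * l ^ (3 * k - 1) := by
        gcongr <;> linarith
    _ = (3 * k * (|a| * b * 4 ^ (k - 1) + 6) + 4) * l ^ (3 * k - 1) := by ring
    _ ≤ l * c * l ^ (3 * k - 1) := by gcongr
    _ = c * l ^ (3 * k - 1 + 1) := by ring
    _ = _ := by rw [Nat.sub_add_cancel (by omega)]

theorem eventually_exists_admissibleParams {k : ℕ} (hk : 2 ≤ k) :
    ∀ᶠ d : ℝ in atTop, ∃ (r₀ r₁ r₂ κ : ℕ) (ω₁ ω₂ ω₃ : ℝ),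
      AdmissibleParams k d r₀ r₁ r₂ κ ω₁ ω₂ ω₃ ∧
      ((r₀ + r₁ + r₂ + 3 * (k * κ) + 2 : ℕ) : ℝ) ≤ alphaParam k d + betaParam k d + 1 ∧
      ((r₀ + r₁ + r₂ : ℕ) : ℝ) ≤ d := by
  have hK : (0 : ℝ) < (k - 1 : ℕ) := by exact_mod_cast (by omega : 0 < k - 1)
  have hlog := Real.tendsto_log_atTop
  have e1 := hlog.eventually (eventually_ge_atTop 4)
  have e2 := hlog.eventually ((tendsto_rpow_atTop (by norm_num : (0 : ℝ) < 1 / 2)).eventually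
    (eventually_ge_atTop (6 * Real.exp (2 ^ k))))
  have e3 := hlog.eventually (eventually_polynomial_le_exp (3 * (k - 1 : ℕ)) (Real.exp (2 ^ k))
    (by positivity))
  have e4 : ∀ᶠ d : ℝ in atTop,
      5 * (k - 1 : ℕ) * Real.log (Real.log d) + 2 * (k - 1 : ℕ) ≤ Real.log d := by
    refine hlog.eventually (p := fun l : ℝ =>
      5 * (k - 1 : ℕ) * Real.log l + 2 * (k - 1 : ℕ) ≤ l) ?_
    have h := Real.isLittleO_log_id_atTop.bound (c := 1 / (10 * (k - 1 : ℕ))) (by positivity)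
    filter_upwards [h, eventually_ge_atTop (4 * ((k - 1 : ℕ) : ℝ)), eventually_ge_atTop 1] with
      l h1 h2 h3
    have h4 : Real.log l ≤ 1 / (10 * (k - 1 : ℕ)) * l := by
      refine (le_abs_self _).trans (h1.trans_eq ?_)
      rw [id, Real.norm_of_nonneg (by linarith)]
    have h5 : 5 * (k - 1 : ℕ) * Real.log l ≤ 5 * (k - 1 : ℕ) * (1 / (10 * (k - 1 : ℕ)) * l) := by
      gcongr
    have h6 : 5 * ((k - 1 : ℕ) : ℝ) * (1 / (10 * (k - 1 : ℕ)) * l) = l / 2 := by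
      field_simp
      ring
    linarith
  have e5 : ∀ᶠ d : ℝ in atTop,
      (2 : ℝ) ^ (k - 1) * 4 ≤ (k - 1 : ℕ) / 2 * Real.log (Real.log d) :=
    ((hlog.comp hlog).const_mul_atTop (by positivity)).eventually_ge_atTop _
  have e6 := hlog.eventually (eventually_polynomial_le_pow hk (Real.exp 2)
    ((2 * Real.exp (2 ^ k)) ^ (k - 1)) 3 (by positivity))
  filter_upwards [eventually_ge_atTop 10, e1, e2, e3, e4, e5, e6] with d h h1 h2 h3 h4 h5 h6
  exact exists_admissibleParams_of_large hk h h1 h2 h3 h4 h5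
    (h6.resolve_right (by norm_num))

/-- The parameters may vary with `n` along with `d n`, but the number of greedy classes stays below
`D` and the error bound depends on `D` alone, so one diameter constant and one rate work throughout.
-/
theorem tendsto_randomHypergraphProb_connected {k : ℕ} (hk : 2 ≤ k) {d₀ D : ℝ} (hd₀ : 2 ≤ d₀)
    (hparams : ∀ d : ℝ, d₀ ≤ d → ∃ (r₀ r₁ r₂ κ : ℕ) (ω₁ ω₂ ω₃ : ℝ),
      AdmissibleParams k d r₀ r₁ r₂ κ ω₁ ω₂ ω₃ ∧
      ((r₀ + r₁ + r₂ + 3 * (k * κ) + 2 : ℕ) : ℝ) ≤ alphaParam k d + betaParam k d + 1 ∧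
      ((r₀ + r₁ + r₂ : ℕ) : ℝ) ≤ d)
    (d : ℕ → ℝ) (q : ℕ → ℕ) (hd : ∀ n, d₀ ≤ d n ∧ d n ≤ D)
    (hq : ∀ n, alphaParam k (d n) + betaParam k (d n) + 1 ≤ (q n : ℝ)) :
    Tendsto
      (fun n : ℕ => randomHypergraphProb n ⌊d n * n / k⌋₊ k
        (fun E => (recoloringGraph E (q n)).Connected ∧ (recoloringGraph E (q n)).ediam ≤
          (((⌊D⌋₊ ^ 2 + 7 * ⌊D⌋₊ + 6) * n : ℕ) : ℕ∞)))
      atTop (𝓝 1) := by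
  have hD : 2 ≤ D := hd₀.trans ((hd 0).1.trans (hd 0).2)
  have hlogD : 0 < Real.log D := Real.log_pos (by linarith)
  have herr := (tendsto_error k (by linarith : 0 < D)).const_sub 1
  rw [sub_zero] at herr
  refine tendsto_of_tendsto_of_tendsto_of_le_of_le' herr tendsto_const_nhds ?_
    (Eventually.of_forall fun n => randomHypergraphProb_le_one _)
  filter_upwards [eventually_exp_neg_le_miss hk (D := D) (η := 1 / Real.log D) (by positivity)]
    with n ⟨hkn, hn, hmiss⟩
  obtain ⟨hdn, hdD⟩ := hd n
  obtain ⟨hm, hmiss⟩ := hmiss (d n) (by linarith) hdD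
  obtain ⟨r₀, r₁, r₂, κ, ω₁, ω₂, ω₃, hadm, hcol, hr⟩ := hparams (d n) hdn
  have hbad := randomHypergraphProb_not_greedyDegenerate_le hk hkn hn (by linarith) hdD hm hmiss
    hadm
  refine le_trans (sub_le_sub_left hbad 1) (one_sub_le_randomHypergraphProb hm ?_)
  intro E hE hgood
  rw [not_not] at hgood
  have hcard : ∀ e ∈ E, 2 ≤ e.card := fun e he => by
    rw [card_of_mem_uniformHypergraphs hE e he]; exact hk
  have hq' : r₀ + r₁ + r₂ + 3 * (k * κ) + 2 ≤ q n := by exact_mod_cast hcol.trans (hq n)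
  obtain ⟨hconn, hdiam⟩ := hgood.connected_and_ediam_le hcard hq'
  refine ⟨hconn, hdiam.trans ?_⟩
  have hrD : r₀ + r₁ + r₂ ≤ ⌊D⌋₊ := Nat.le_floor (hr.trans hdD)
  exact_mod_cast (by gcongr : ((r₀ + r₁ + r₂) ^ 2 + 7 * (r₀ + r₁ + r₂) + 6) * n ≤
    (⌊D⌋₊ ^ 2 + 7 * ⌊D⌋₊ + 6) * n)

end Parameters

theorem theorem1 (k : ℕ) (hk : 2 ≤ k) :
    ∃ d₀ : ℝ, ∀ D : ℝ,
      (∀ (d : ℕ → ℝ) (q : ℕ → ℕ),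
        (∀ n, d₀ ≤ d n ∧ d n ≤ D) →
        (∀ n, alphaParam k (d n) + betaParam k (d n) + 1 ≤ (q n : ℝ)) →
        Tendsto
          (fun n : ℕ => randomHypergraphProb n ⌊d n * n / k⌋₊ k
            (fun E => (recoloringGraph E (q n)).Connected))
          atTop (𝓝 1)) ∧
      (∃ C : ℕ, ∀ (d : ℕ → ℝ) (q : ℕ → ℕ),
        (∀ n, d₀ ≤ d n ∧ d n ≤ D) →
        (∀ n, alphaParam k (d n) + 2 * betaParam k (d n) + 1 ≤ (q n : ℝ)) →
        Tendsto
          (fun n : ℕ => randomHypergraphProb n ⌊d n * n / k⌋₊ k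
            (fun E => (recoloringGraph E (q n)).Connected ∧
              (recoloringGraph E (q n)).ediam ≤ ((C * n : ℕ) : ℕ∞)))
          atTop (𝓝 1)) := by
  obtain ⟨d₁, hd₁⟩ := eventually_atTop.1 (eventually_exists_admissibleParams hk)
  -- The diameter constant is `r ^ 2 + 7 * r + 6` at `r = ⌊D⌋₊`, the largest number of greedy
  -- classes that can occur.
  refine ⟨max d₁ 2, fun D => ⟨fun d q hd hq => ?_, ⌊D⌋₊ ^ 2 + 7 * ⌊D⌋₊ + 6, fun d q hd hq => ?_⟩⟩
  · refine tendsto_of_tendsto_of_tendsto_of_le_of_le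
      (tendsto_randomHypergraphProb_connected hk (le_max_right d₁ 2)
        (fun d hd => hd₁ d ((le_max_left _ _).trans hd)) d q hd hq) tendsto_const_nhds
      (fun n => randomHypergraphProb_mono fun E _ hE => hE.1)
      (fun n => randomHypergraphProb_le_one _)
  · refine tendsto_randomHypergraphProb_connected hk (le_max_right d₁ 2)
      (fun d hd => hd₁ d ((le_max_left _ _).trans hd)) d q hd fun n => le_trans ?_ (hq n)
    have h2 : 2 ≤ d n := (le_max_right d₁ 2).trans (hd n).1
    have hlog : 0 ≤ Real.log (d n) := Real.log_nonneg (by linarith)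
    have hβ : 0 ≤ betaParam k (d n) := by unfold betaParam; positivity
    linarith
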